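/- Consider the noise-free networked control system $$x_{k+1}=Ax_k+Bu_k+B^P\tilde u^P_k,\qquad B=\begin{bmatrix}B^W&B^P\end{bmatrix},\qquad k\ge 0,$$ with state $x_k\in\mathbb R^n$, real matrices $A,B^W,B^P,H$, and the observations $$y^W_k=\beta_kx_k,\qquad y^P_k=Hx_k+v_k .$$ Here $x_0$ is Gaussian (with arbitrary mean and covariance), $(v_k)$ is Gaussian white noise with mean $0$ and covariance $Q_v\ge 0$, $(\beta_k)$ is an i.i.d. sequence with $\mathbb P(\beta_k=0)=p$, $\mathbb P(\beta_k=1)=1-p$, where $0\le p<1$, and $x_0$, $(v_k)$, $(\beta_k)$ are independent. Put $$\hat x^W_{k|k}=\mathbb E[x_k\mid y^W_0,\dots,y^W_k],\qquad \hat x^P_{k|k}=\mathbb E[x_k\mid y^W_0,\dots,y^W_k,y^P_0,\dots,y^P_k].$$ The system is called stabilizable in the mean-square sense if there are constant matrices $L^W,L^P$ such that, with $u_k=L^W\hat x^W_{k|k}$ and $\tilde u^P_k=L^P(\hat x^P_{k|k}-\hat x^W_{k|k})$, the closed-loop state satisfies $\lim_{k\to\infty}\mathbb E(x_k'x_k)=0$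 for every initial value $x_0$. Assume that 1. $R^P>0$, $R^W>0$ and $Q\ge 0$; 2. $(A,Q^{1/2})$ is observable and $(A,H)$ is detectable; 3. $(A,[B^W\ B^P])$ is stabilizable; 4. $(A,B^P)$ is stabilizable, and $(A,D)$ is observable where $pQ+(1-p)P^W=DD'$ and $P^W>0$ is the positive definite solution of the algebraic Riccati equation $P^W=A'P^WA-M'\Gamma^{-1}M+Q$ with $\Gamma=B'P^WB+R$, $M=B'P^WA$, $R=\mathrm{diag}(R^W,R^P)$. Then the system is stabilizable in the mean-square sense. -/

import Mathlib

open Filter Topology MeasureTheory ProbabilityTheory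
open scoped Matrix

universe u

namespace NCS

/-! ### Linear systems notions (discrete time) -/

section Linear

variable {ι κ : Type*} [Fintype ι] [DecidableEq ι] [Fintype κ]

/-- The recursion `z (k+1) = F z k` is asymptotically stable: all its solutions tend to `0`. -/
def IsStable (F : Matrix ι ι ℝ) : Prop :=
  ∀ z : ι → ℝ, Tendsto (fun k : ℕ => (F ^ k) *ᵥ z) atTop (𝓝 0)

/-- `(A, B)` is stabilizable: some state feedback makes `A + B K` asymptotically stable. -/
def Stabilizable (A : Matrix ι ι ℝ) (B : Matrix ι κ ℝ) : Prop :=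
  ∃ K : Matrix κ ι ℝ, IsStable (A + B * K)

/-- `(A, H)` is detectable: some output injection makes `A + K H` asymptotically stable. -/
def Detectable (A : Matrix ι ι ℝ) (H : Matrix κ ι ℝ) : Prop :=
  ∃ K : Matrix ι κ ℝ, IsStable (A + K * H)

/-- `(A, C)` is observable: an initial state of `z (k+1) = A z k` whose outputs `C z k` all vanish
is zero. -/
def Observable (A : Matrix ι ι ℝ) (C : Matrix κ ι ℝ) : Prop :=
  ∀ z : ι → ℝ, (∀ k : ℕ, C *ᵥ ((A ^ k) *ᵥ z) = 0) → z = 0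

end Linear

/-! ### The networked control system -/

/-- The data of the system: the state has dimension `n`, the remote input dimension `w`, the
embedded input dimension `e`, and the local observation dimension `m`. -/
structure System (n w e m : ℕ) where
  /-- state matrix -/
  A : Matrix (Fin n) (Fin n) ℝ
  /-- input matrix of the remote controller -/
  BW : Matrix (Fin n) (Fin w) ℝ
  /-- input matrix of the embedded controller -/
  BP : Matrix (Fin n) (Fin e) ℝ
  /-- observation matrix of the embedded controller -/
  H : Matrix (Fin m) (Fin n) ℝ
  /-- covariance of the observation noise -/
  Qv : Matrix (Fin m) (Fin m) ℝ
  /-- packet dropout probability -/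
  p : ℝ

variable {n w e m : ℕ}

/-- The joint input matrix `B = [B^W B^P]`. -/
def System.B (S : System n w e m) : Matrix (Fin n) (Fin w ⊕ Fin e) ℝ :=
  Matrix.fromCols S.BW S.BP

/-- `PW` solves the algebraic Riccati equation
`P^W = A' P^W A - M' Γ⁻¹ M + Q`, where `Γ = B' P^W B + R`, `M = B' P^W A` and
`R = diag(R^W, R^P)`. -/
def System.SolvesRiccati (S : System n w e m) (Q : Matrix (Fin n) (Fin n) ℝ)
    (RW : Matrix (Fin w) (Fin w) ℝ) (RP : Matrix (Fin e) (Fin e) ℝ)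
    (PW : Matrix (Fin n) (Fin n) ℝ) : Prop :=
  let Γ := S.Bᵀ * PW * S.B + Matrix.fromBlocks RW 0 0 RP
  let M := S.Bᵀ * PW * S.A
  PW = S.Aᵀ * PW * S.A - Mᵀ * Γ⁻¹ * M + Q

section Stochastic

variable {Ω : Type u}

/-- The observation `y^W k = β k • x k` of the remote controller. -/
def remoteObs (β : ℕ → Ω → ℝ) (x : ℕ → Ω → EuclideanSpace ℝ (Fin n)) (k : ℕ) :
    Ω → EuclideanSpace ℝ (Fin n) :=
  fun ω => β k ω • x k ω

/-- The observation `y^P k = H x k + v k` of the embedded controller. -/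
noncomputable def System.embeddedObs (S : System n w e m)
    (v : ℕ → Ω → EuclideanSpace ℝ (Fin m)) (x : ℕ → Ω → EuclideanSpace ℝ (Fin n)) (k : ℕ) :
    Ω → EuclideanSpace ℝ (Fin m) :=
  fun ω => Matrix.toEuclideanLin S.H (x k ω) + v k ω

/-- The σ-algebra generated by `y^W 0, …, y^W k`. -/
@[reducible]
def remoteInfo (β : ℕ → Ω → ℝ) (x : ℕ → Ω → EuclideanSpace ℝ (Fin n)) (k : ℕ) :
    MeasurableSpace Ω :=
  ⨆ j ≤ k, MeasurableSpace.comap (remoteObs β x j) inferInstance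

/-- The σ-algebra generated by `y^W 0, …, y^W k, y^P 0, …, y^P k`. -/
@[reducible]
noncomputable def System.embeddedInfo (S : System n w e m) (β : ℕ → Ω → ℝ)
    (v : ℕ → Ω → EuclideanSpace ℝ (Fin m)) (x : ℕ → Ω → EuclideanSpace ℝ (Fin n)) (k : ℕ) :
    MeasurableSpace Ω :=
  remoteInfo β x k ⊔ ⨆ j ≤ k, MeasurableSpace.comap (S.embeddedObs v x j) inferInstance

variable [MeasurableSpace Ω]

/-- The estimate `E[x k | y^W 0, …, y^W k]` of the remote controller. -/
noncomputable def remoteEst (P : Measure Ω) (β : ℕ → Ω → ℝ)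
    (x : ℕ → Ω → EuclideanSpace ℝ (Fin n)) (k : ℕ) : Ω → EuclideanSpace ℝ (Fin n) :=
  P[x k | remoteInfo β x k]

/-- The estimate `E[x k | y^W 0, …, y^W k, y^P 0, …, y^P k]` of the embedded controller. -/
noncomputable def System.embeddedEst (S : System n w e m) (P : Measure Ω) (β : ℕ → Ω → ℝ)
    (v : ℕ → Ω → EuclideanSpace ℝ (Fin m)) (x : ℕ → Ω → EuclideanSpace ℝ (Fin n)) (k : ℕ) :
    Ω → EuclideanSpace ℝ (Fin n) :=
  P[x k | S.embeddedInfo β v x k]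

/-- The standing probabilistic assumptions: `x0` is Gaussian with some mean and some covariance
(possibly degenerate), `v` is Gaussian white noise with covariance `Qv`, the `β k` are i.i.d. with
`β k = 0` with probability `p` and `β k = 1` with probability `1 - p`, and
`x0`, the sequence `v` and the sequence `β` are independent. -/
structure System.IsRandomModel (S : System n w e m) (P : Measure Ω)
    (x0 : Ω → EuclideanSpace ℝ (Fin n)) (v : ℕ → Ω → EuclideanSpace ℝ (Fin m))
    (β : ℕ → Ω → ℝ) : Prop where
  measurable_x0 : Measurable x0
  measurable_v : ∀ k, Measurable (v k)
  measurable_β : ∀ k, Measurable (β k)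
  law_x0 : ∃ (μ : EuclideanSpace ℝ (Fin n)) (σ : Matrix (Fin n) (Fin n) ℝ),
    σ.PosSemidef ∧ HasLaw x0 (multivariateGaussian μ σ) P
  law_v : ∀ k, HasLaw (v k) (multivariateGaussian 0 S.Qv) P
  dropout : ∀ k, P.real {ω | β k ω = 0} = S.p
  success : ∀ k, P.real {ω | β k ω = 1} = 1 - S.p
  indep_v : iIndepFun v P
  indep_β : iIndepFun β P
  indep_x0_v : IndepFun x0 (fun ω k => v k ω) P
  indep_x0_v_β : IndepFun (fun ω => (x0 ω, fun k => v k ω)) (fun ω k => β k ω) P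

/-- `x` is the state of the noise-free system `x (k+1) = A x k + B u k + B^P ũ^P k` started at `x0`,
in closed loop with `u k = L^W x̂^W k` and `ũ^P k = L^P (x̂^P k - x̂^W k)`. -/
def System.IsClosedLoop (S : System n w e m) (P : Measure Ω)
    (LW : Matrix (Fin w ⊕ Fin e) (Fin n) ℝ) (LP : Matrix (Fin e) (Fin n) ℝ)
    (x0 : Ω → EuclideanSpace ℝ (Fin n)) (v : ℕ → Ω → EuclideanSpace ℝ (Fin m))
    (β : ℕ → Ω → ℝ) (x : ℕ → Ω → EuclideanSpace ℝ (Fin n)) : Prop :=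
  x 0 = x0 ∧ ∀ k ω,
    x (k + 1) ω = Matrix.toEuclideanLin S.A (x k ω)
      + Matrix.toEuclideanLin S.B (Matrix.toEuclideanLin LW (remoteEst P β x k ω))
      + Matrix.toEuclideanLin S.BP
          (Matrix.toEuclideanLin LP (S.embeddedEst P β v x k ω - remoteEst P β x k ω))

end Stochastic

/-- The noise-free system is stabilizable in the mean-square sense: there are constant gains
`L^W`, `L^P` such that, whatever the initial value (and whatever the probability space that carries
the random elements of the model), the closed-loop state has finite second moments
and `E (x k)' (x k) → 0`. -/
def System.MeanSquareStabilizable (S : System n w e m) : Prop :=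
  ∃ (LW : Matrix (Fin w ⊕ Fin e) (Fin n) ℝ) (LP : Matrix (Fin e) (Fin n) ℝ),
    ∀ (Ω : Type u) [MeasurableSpace Ω] (P : Measure Ω) [IsProbabilityMeasure P]
      (x0 : Ω → EuclideanSpace ℝ (Fin n)) (v : ℕ → Ω → EuclideanSpace ℝ (Fin m))
      (β : ℕ → Ω → ℝ) (x : ℕ → Ω → EuclideanSpace ℝ (Fin n)),
      S.IsRandomModel P x0 v β → S.IsClosedLoop P LW LP x0 v β x →
      (∀ k, Integrable (fun ω => ‖x k ω‖ ^ 2) P) ∧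
        Tendsto (fun k => ∫ ω, ‖x k ω‖ ^ 2 ∂P) atTop (𝓝 0)

/-! ### The closed-loop state exists and is unique -/

section Existence

variable {Ω : Type u}

theorem remoteInfo_congr {β : ℕ → Ω → ℝ} {x y : ℕ → Ω → EuclideanSpace ℝ (Fin n)} {k : ℕ}
    (h : ∀ j ≤ k, x j = y j) : remoteInfo β x k = remoteInfo β y k := by
  unfold remoteInfo
  refine iSup_congr fun j => iSup_congr fun hj => ?_
  have : remoteObs β x j = remoteObs β y j := by unfold remoteObs; rw [h j hj]
  rw [this]

theorem System.embeddedInfo_congr (S : System n w e m) {β : ℕ → Ω → ℝ}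
    {v : ℕ → Ω → EuclideanSpace ℝ (Fin m)} {x y : ℕ → Ω → EuclideanSpace ℝ (Fin n)} {k : ℕ}
    (h : ∀ j ≤ k, x j = y j) : S.embeddedInfo β v x k = S.embeddedInfo β v y k := by
  unfold System.embeddedInfo
  rw [remoteInfo_congr h]
  congr 1
  refine iSup_congr fun j => iSup_congr fun hj => ?_
  have : S.embeddedObs v x j = S.embeddedObs v y j := by unfold System.embeddedObs; rw [h j hj]
  rw [this]

theorem existsUnique_causal_recursion {α : Type*} (a : α) (F : (ℕ → α) → ℕ → α)
    (hF : ∀ x y k, (∀ j ≤ k, x j = y j) → F x k = F y k) :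
    ∃! x : ℕ → α, x 0 = a ∧ ∀ k, x (k + 1) = F x k := by
  let g : ℕ → (ℕ → α) := fun k =>
    Nat.rec (fun _ => a) (fun k gk => Function.update gk (k + 1) (F gk k)) k
  have g_zero : g 0 0 = a := rfl
  have g_succ : ∀ k, g (k + 1) = Function.update (g k) (k + 1) (F (g k) k) := fun _ => rfl
  clear_value g
  have g_stable : ∀ j d, g (j + d) j = g j j := by
    intro j d
    induction d with
    | zero => rfl
    | succ d ih => rw [← add_assoc, g_succ, Function.update_of_ne (by omega), ih]
  refine ⟨fun k => g k k, ⟨g_zero, fun k => ?_⟩, fun y hy => ?_⟩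
  · have h1 : g (k + 1) (k + 1) = F (g k) k := by rw [g_succ, Function.update_self]
    refine h1.trans (hF _ _ _ fun j hj => ?_)
    obtain ⟨d, rfl⟩ := Nat.exists_eq_add_of_le hj
    exact g_stable j d
  · have key : ∀ k, ∀ j ≤ k, y j = g j j := by
      intro k
      induction k with
      | zero =>
        intro j hj
        obtain rfl : j = 0 := by omega
        rw [hy.1, g_zero]
      | succ k ih =>
        intro j hj
        rcases Nat.lt_or_ge j (k + 1) with hlt | hge
        · exact ih j (by omega)
        · obtain rfl : j = k + 1 := by omega
          rw [hy.2, g_succ, Function.update_self]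
          refine hF _ _ _ fun i hi => ?_
          rw [ih i hi]
          obtain ⟨d, rfl⟩ := Nat.exists_eq_add_of_le hi
          exact (g_stable i d).symm
    exact funext fun k => key k k le_rfl

theorem System.existsUnique_isClosedLoop [MeasurableSpace Ω] (S : System n w e m)
    (P : Measure Ω) (LW : Matrix (Fin w ⊕ Fin e) (Fin n) ℝ) (LP : Matrix (Fin e) (Fin n) ℝ)
    (x0 : Ω → EuclideanSpace ℝ (Fin n)) (v : ℕ → Ω → EuclideanSpace ℝ (Fin m))
    (β : ℕ → Ω → ℝ) : ∃! x, S.IsClosedLoop P LW LP x0 v β x := by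
  have h := existsUnique_causal_recursion x0
    (fun x k ω => Matrix.toEuclideanLin S.A (x k ω)
      + Matrix.toEuclideanLin S.B (Matrix.toEuclideanLin LW (remoteEst P β x k ω))
      + Matrix.toEuclideanLin S.BP
          (Matrix.toEuclideanLin LP (S.embeddedEst P β v x k ω - remoteEst P β x k ω)))
    (by
      intro x y k h
      simp only [remoteEst, System.embeddedEst, remoteInfo_congr h, S.embeddedInfo_congr h,
        h k le_rfl])
  simpa only [System.IsClosedLoop, funext_iff] using h

end Existence

end NCS

/-! Any gains with `S.A + S.B * LW` and `S.A + S.BP * LP` stable work. The argument splits the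
sample space at time `k` by `silence`, the event that every remote observation up to `k` was zero.

Off silence the state was received exactly at some time, and the dynamics carry no process noise.
Both controllers therefore know the state (`ests_eq_state`), the correction through `LP` vanishes,
and the state obeys the stable recursion `S.A + S.B * LW`.

On silence the remote estimate is a deterministic vector, `silentMean`. It evolves by `S.A + S.B *
LW` up to factors in `[0, 1]`, hence tends to `0` (`tendsto_silentMean`). The state then obeys `S.A
+ S.BP * LP`, disturbed by this vector and by the embedded estimation error
(`state_succ_of_silence`).

The delicate point is that this error vanishes although the observation noise persists
(`tendsto_integral_silent_error`). Silence need not become improbable, since a zero state is silent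
even when packets arrive; but silence with a nonzero state does (`tendsto_real_silence_ne_zero`).
Detectability gives an observer whose error is bounded in `L⁴`. Replacing its output by `0` below a
level `M` costs `O(1 / M ^ 2)` where the state is `0`, and an extra `O(M ^ 2)` only on the
improbable event. The conditional expectation does at least as well; fixing `M` large and then
letting `k` grow gives the limit.

The silent part of the state thus vanishes in mean square. The remaining part is a stable recursion
fed only by states leaving silence, so it vanishes as well. -/

namespace NCS

/-! ### Stable recursions -/

/-- A nonnegative sequence driven by a vanishing input through a contraction vanishes. -/
theorem tendsto_zero_of_le_mul_add {a b : ℕ → ℝ} {ρ : ℝ} (hρ0 : 0 ≤ ρ) (hρ1 : ρ < 1)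
    (ha : ∀ k, 0 ≤ a k) (hb : Tendsto b atTop (𝓝 0)) (h : ∀ k, a (k + 1) ≤ ρ * a k + b k) :
    Tendsto a atTop (𝓝 0) := by
  rw [Metric.tendsto_atTop]
  intro ε hε
  have hδ : 0 < (1 - ρ) * (ε / 2) := by have : 0 < 1 - ρ := by linarith
                                        positivity
  obtain ⟨N, hN⟩ := (Metric.tendsto_atTop.1 hb) _ hδ
  have key : ∀ j, a (N + j) ≤ ρ ^ j * a N + ε / 2 := by
    intro j
    induction j with
    | zero => simp; linarith
    | succ j ih =>
      have h1 := h (N + j)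
      have h2 : b (N + j) < (1 - ρ) * (ε / 2) := by
        have := hN (N + j) (by omega)
        rw [Real.dist_eq, sub_zero] at this
        exact (le_abs_self _).trans_lt this
      have h3 := mul_le_mul_of_nonneg_left ih hρ0
      rw [← add_assoc]
      calc _ ≤ _ := h1
        _ ≤ ρ * (ρ ^ j * a N + ε / 2) + (1 - ρ) * (ε / 2) := by linarith
        _ = _ := by ring
  have hlim : Tendsto (fun j => ρ ^ j * a N) atTop (𝓝 0) := by
    simpa using (tendsto_pow_atTop_nhds_zero_of_lt_one hρ0 hρ1).mul_const (a N)
  obtain ⟨J, hJ⟩ := (Metric.tendsto_atTop.1 hlim) (ε / 2) (by linarith)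
  refine ⟨N + J, fun k hk => ?_⟩
  obtain ⟨i, rfl⟩ := Nat.exists_eq_add_of_le hk
  have h1 := key (J + i)
  have h2 := hJ (J + i) (by omega)
  rw [Real.dist_eq, sub_zero] at h2
  have h3 := (le_abs_self _).trans_lt h2
  rw [Real.dist_eq, sub_zero, add_assoc, abs_of_nonneg (ha _)]
  linarith

/-- A nonnegative sequence driven by a bounded input through a contraction is bounded. -/
theorem bounded_of_le_mul_add {a : ℕ → ℝ} {ρ b : ℝ} (hρ0 : 0 ≤ ρ) (hρ1 : ρ < 1)
    (h : ∀ k, a (k + 1) ≤ ρ * a k + b) : ∃ C, ∀ k, a k ≤ C := by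
  refine ⟨max (a 0) (b / (1 - ρ)), fun k => ?_⟩
  induction k with
  | zero => exact le_max_left _ _
  | succ k ih =>
    have h1 : b ≤ (1 - ρ) * max (a 0) (b / (1 - ρ)) := by
      have : 0 < 1 - ρ := by linarith
      rw [← div_le_iff₀' this]
      exact le_max_right _ _
    have := mul_le_mul_of_nonneg_left ih hρ0
    linarith [h k]

/-! ### Quadratic-type Lyapunov functions of stable linear maps -/

section Lyapunov

variable {E : Type*} [NormedAddCommGroup E] [NormedSpace ℝ E]

/-- In finite dimension pointwise convergence of the powers is convergence in norm. -/
theorem exists_norm_pow_le_half [FiniteDimensional ℝ E] (L : E →L[ℝ] E)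
    (hL : ∀ z, Tendsto (fun k : ℕ => (L ^ k) z) atTop (𝓝 0)) :
    ∃ N : ℕ, N ≠ 0 ∧ ‖L ^ N‖ ≤ 1 / 2 := by
  let b := Module.finBasis ℝ E
  obtain ⟨C, hC0, hC⟩ := b.exists_opNorm_le (F := E)
  have h1 : ∀ᶠ k : ℕ in atTop, ∀ i, ‖(L ^ k) (b i)‖ < 1 / (2 * C) := by
    rw [eventually_all]
    intro i
    have := (hL (b i)).norm
    rw [norm_zero] at this
    exact this.eventually (gt_mem_nhds (by positivity))
  obtain ⟨N, hN, hN0⟩ := (h1.and (eventually_ge_atTop 1)).exists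
  refine ⟨N, by omega, ?_⟩
  refine (hC (M := 1 / (2 * C)) (by positivity) fun i => (hN i).le).trans (le_of_eq ?_)
  field_simp

/-- A stable linear map contracts an equivalent norm. -/
theorem exists_contracting_norm (L : E →L[ℝ] E) {N : ℕ} (hN : N ≠ 0) (hL : ‖L ^ N‖ ≤ 1 / 2) :
    ∃ (r : E → ℝ) (θ C : ℝ), Continuous r ∧ 0 ≤ θ ∧ θ < 1 ∧ 0 ≤ C ∧ (∀ x, ‖x‖ ≤ r x) ∧
      (∀ x, r x ≤ C * ‖x‖) ∧ (∀ x y, r (x + y) ≤ r x + r y) ∧ ∀ x, r (L x) ≤ θ * r x := by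
  -- With `θ ^ N = 1 / 2`, applying `L` shifts the weighted sum `r` and gains a factor `θ`. The new
  -- last term `θ⁻¹ ^ N * ‖(L ^ N) x‖` is at most `‖x‖`, which is the first term lost in the shift.
  obtain ⟨θ, hθ0, hθ1, hθN⟩ : ∃ θ : ℝ, 0 < θ ∧ θ < 1 ∧ θ ^ N = 1 / 2 := by
    refine ⟨(1 / 2 : ℝ) ^ ((N : ℝ)⁻¹), by positivity, ?_, ?_⟩
    · exact Real.rpow_lt_one (by norm_num) (by norm_num) (by positivity)
    · exact Real.rpow_inv_natCast_pow (by norm_num) hN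
  let r : E → ℝ := fun x => ∑ j ∈ Finset.range N, θ⁻¹ ^ j * ‖(L ^ j) x‖
  refine ⟨r, θ, ∑ j ∈ Finset.range N, θ⁻¹ ^ j * ‖L ^ j‖, ?_, hθ0.le, hθ1, ?_, ?_, ?_, ?_, ?_⟩
  · fun_prop
  · exact Finset.sum_nonneg fun _ _ => by positivity
  · intro x
    have := Finset.single_le_sum (f := fun j => θ⁻¹ ^ j * ‖(L ^ j) x‖) (s := Finset.range N)
      (fun _ _ => by positivity) (Finset.mem_range.2 (Nat.pos_of_ne_zero hN))
    rwa [pow_zero, one_mul] at this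
  · intro x
    simp only [r, Finset.sum_mul, mul_assoc]
    gcongr with j
    exact (L ^ j).le_opNorm x
  · intro x y
    simp only [r, map_add, ← Finset.sum_add_distrib, ← mul_add]
    gcongr with j
    exact norm_add_le _ _
  · intro x
    have h1 : ∀ j, θ⁻¹ ^ j * ‖(L ^ j) (L x)‖ = θ * (θ⁻¹ ^ (j + 1) * ‖(L ^ (j + 1)) x‖) := by
      intro j
      rw [pow_succ L, pow_succ θ⁻¹]
      simp only [mul_apply_eq_comp]
      field_simp
    have h2 := Finset.sum_range_succ (fun j => θ⁻¹ ^ j * ‖(L ^ j) x‖) N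
    have h3 := Finset.sum_range_succ' (fun j => θ⁻¹ ^ j * ‖(L ^ j) x‖) N
    have h4 : θ⁻¹ ^ N * ‖(L ^ N) x‖ ≤ ‖x‖ := by
      rw [inv_pow, hθN]
      have := (L ^ N).le_of_opNorm_le hL x
      linarith
    simp only [r, h1, ← Finset.mul_sum]
    simp only [pow_zero, one_mul, one_apply_eq_self] at h3
    refine mul_le_mul_of_nonneg_left ?_ hθ0.le
    linarith

/-- A Lyapunov function of a stable linear map, which also measures the effect of an input. -/
theorem exists_lyapunov [FiniteDimensional ℝ E] (L : E →L[ℝ] E)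
    (hL : ∀ z, Tendsto (fun k : ℕ => (L ^ k) z) atTop (𝓝 0)) :
    ∃ (q : E → ℝ) (ρ C : ℝ), Continuous q ∧ 0 ≤ ρ ∧ ρ < 1 ∧ 0 ≤ C ∧ (∀ x, ‖x‖ ^ 2 ≤ q x) ∧
      (∀ x, q x ≤ C * ‖x‖ ^ 2) ∧ ∀ x y, q (L x + y) ≤ ρ * q x + C * ‖y‖ ^ 2 := by
  obtain ⟨N, hN, hLN⟩ := exists_norm_pow_le_half L hL
  obtain ⟨r, θ, C, hr, hθ0, hθ1, hC, hlow, hup, hadd, hcontr⟩ := exists_contracting_norm L hN hLN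
  have hθ : 0 < 1 - θ := by linarith
  have hr0 : ∀ x, 0 ≤ r x := fun x => (norm_nonneg x).trans (hlow x)
  refine ⟨fun x => r x ^ 2, θ, C ^ 2 + C ^ 2 / (1 - θ), by fun_prop, hθ0, hθ1, by positivity,
    fun x => ?_, fun x => ?_, fun x y => ?_⟩
  · exact pow_le_pow_left₀ (norm_nonneg x) (hlow x) 2
  · calc r x ^ 2 ≤ (C * ‖x‖) ^ 2 := pow_le_pow_left₀ (hr0 x) (hup x) 2
      _ = C ^ 2 * ‖x‖ ^ 2 := by ring
      _ ≤ _ := by gcongr; exact le_add_of_nonneg_right (by positivity)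
  · have h1 : r (L x + y) ≤ θ * r x + C * ‖y‖ :=
      (hadd _ _).trans (add_le_add (hcontr x) (hup y))
    have h2 : r (L x + y) ^ 2 ≤ (θ * r x + C * ‖y‖) ^ 2 := pow_le_pow_left₀ (hr0 _) h1 2
    -- Convexity of the square with weights `θ` and `1 - θ`, at the points `r x` and `C * ‖y‖ / (1 -
    -- θ)`.
    have h3 : (θ * r x + C * ‖y‖) ^ 2 ≤ θ * r x ^ 2 + C ^ 2 / (1 - θ) * ‖y‖ ^ 2 := by
      have h4 : θ * r x ^ 2 + C ^ 2 / (1 - θ) * ‖y‖ ^ 2 - (θ * r x + C * ‖y‖) ^ 2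
          = θ * ((1 - θ) * r x - C * ‖y‖) ^ 2 / (1 - θ) := by field_simp; ring
      have h5 : 0 ≤ θ * ((1 - θ) * r x - C * ‖y‖) ^ 2 / (1 - θ) := by positivity
      linarith
    have h6 : (C ^ 2 + C ^ 2 / (1 - θ)) * ‖y‖ ^ 2
        = C ^ 2 / (1 - θ) * ‖y‖ ^ 2 + C ^ 2 * ‖y‖ ^ 2 := by ring
    have h7 : 0 ≤ C ^ 2 * ‖y‖ ^ 2 := by positivity
    linarith

end Lyapunov

theorem IsStable.tendsto_toEuclideanCLM {n : ℕ} {F : Matrix (Fin n) (Fin n) ℝ} (hF : IsStable F)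
    (z : EuclideanSpace ℝ (Fin n)) :
    Tendsto (fun k : ℕ => (Matrix.toEuclideanCLM (𝕜 := ℝ) F ^ k) z) atTop (𝓝 0) := by
  have h := ((PiLp.continuous_toLp 2 (fun _ : Fin n => ℝ)).tendsto 0).comp (hF z.ofLp)
  simp only [← map_pow]
  exact h

/-! ### Conditional expectations and moments -/

section Measure

variable {Ω : Type*} {m₀ : MeasurableSpace Ω} {P : Measure Ω}

/-- Intersections of an `m₁`-set with an `m₂`-set form a π-system generating the supremum, and on
them the product rule follows by using the two independence hypotheses in turn. -/
theorem indep_sup_left [IsProbabilityMeasure P] {m₁ m₂ m₃ : MeasurableSpace Ω} (h₁ : m₁ ≤ m₀)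
    (h₂ : m₂ ≤ m₀) (h₃ : m₃ ≤ m₀) (h : Indep m₁ (m₂ ⊔ m₃) P) (h' : Indep m₂ m₃ P) :
    Indep (m₁ ⊔ m₂) m₃ P := by
  let C : Set (Set Ω) := {s | ∃ a b, MeasurableSet[m₁] a ∧ MeasurableSet[m₂] b ∧ s = a ∩ b}
  have hC : m₁ ⊔ m₂ = MeasurableSpace.generateFrom C := by
    apply le_antisymm
    · refine sup_le (fun s hs => ?_) fun s hs => ?_
      · exact MeasurableSpace.measurableSet_generateFrom
          ⟨s, Set.univ, hs, MeasurableSet.univ, by simp⟩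
      · exact MeasurableSpace.measurableSet_generateFrom
          ⟨Set.univ, s, MeasurableSet.univ, hs, by simp⟩
    · refine MeasurableSpace.generateFrom_le ?_
      rintro s ⟨a, b, ha, hb, rfl⟩
      have h1 : MeasurableSet[m₁ ⊔ m₂] a := (le_sup_left : m₁ ≤ m₁ ⊔ m₂) a ha
      have h2 : MeasurableSet[m₁ ⊔ m₂] b := (le_sup_right : m₂ ≤ m₁ ⊔ m₂) b hb
      exact MeasurableSet.inter h1 h2
  have hpi : IsPiSystem C := by
    rintro s ⟨a, b, ha, hb, rfl⟩ t ⟨c, d, hc, hd, rfl⟩ -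
    exact ⟨a ∩ c, b ∩ d, MeasurableSet.inter ha hc, MeasurableSet.inter hb hd,
      Set.inter_inter_inter_comm a b c d⟩
  refine IndepSets.indep (sup_le h₁ h₂) h₃ hpi (@MeasurableSpace.isPiSystem_measurableSet _ m₃) hC
    (@MeasurableSpace.generateFrom_measurableSet _ m₃).symm ?_
  rw [IndepSets_iff]
  rintro s t ⟨a, b, ha, hb, rfl⟩ ht
  rw [Indep_iff] at h h'
  have hb' : MeasurableSet[m₂ ⊔ m₃] b := (le_sup_left : m₂ ≤ m₂ ⊔ m₃) b hb
  have ht' : MeasurableSet[m₂ ⊔ m₃] t := (le_sup_right : m₃ ≤ m₂ ⊔ m₃) t ht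
  rw [Set.inter_assoc, h a (b ∩ t) ha (MeasurableSet.inter hb' ht'), h' b t hb ht, h a b ha hb',
    mul_assoc]

/-- A function measurable with respect to finitely many observations depends only on them. -/
theorem eq_of_stronglyMeasurable_iSup_comap {E F : Type*} [MeasurableSpace F]
    [TopologicalSpace E] [TopologicalSpace.PseudoMetrizableSpace E] [T1Space E]
    {Y : ℕ → Ω → F} {k : ℕ} {f : Ω → E}
    (hf : StronglyMeasurable[⨆ j ≤ k, MeasurableSpace.comap (Y j) inferInstance] f) {ω ω' : Ω}
    (h : ∀ j ≤ k, Y j ω = Y j ω') : f ω = f ω' := by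
  -- The σ-algebra of the sets that do not separate `ω` from `ω'`. It contains every observable
  -- event, so the conclusion holds at every point and not just almost surely.
  let N : MeasurableSpace Ω :=
    { MeasurableSet' := fun s => ω ∈ s ↔ ω' ∈ s
      measurableSet_empty := by simp
      measurableSet_compl := fun s hs => not_congr hs
      measurableSet_iUnion := fun s hs => by
        simp only [Set.mem_iUnion]
        exact exists_congr hs }
  have hN : (⨆ j ≤ k, MeasurableSpace.comap (Y j) inferInstance) ≤ N := by
    refine iSup₂_le fun j hj => ?_
    rintro s ⟨t, -, rfl⟩
    change Y j ω ∈ t ↔ Y j ω' ∈ t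
    rw [h j hj]
  borelize E
  have h1 : MeasurableSet[N] (f ⁻¹' {f ω}) :=
    hN _ (hf.measurable (measurableSet_singleton (f ω)))
  exact ((h1 : ω ∈ f ⁻¹' {f ω} ↔ ω' ∈ f ⁻¹' {f ω}).1 rfl).symm

section Hilbert

variable {E : Type*} [NormedAddCommGroup E] [InnerProductSpace ℝ E] [CompleteSpace E]

/-- The conditional expectation is the best approximation in mean square. -/
theorem integral_norm_sub_condExp_sq_le [IsFiniteMeasure P] {m : MeasurableSpace Ω} (hm : m ≤ m₀)
    {X Z : Ω → E} (hX : MemLp X 2 P) (hZ : MemLp Z 2 P) (hZm : StronglyMeasurable[m] Z) :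
    ∫ ω, ‖X ω - (P[X | m]) ω‖ ^ 2 ∂P ≤ ∫ ω, ‖X ω - Z ω‖ ^ 2 ∂P := by
  have hY : MemLp (P[X | m]) 2 P := hX.condExp one_le_two
  have hXY := hX.sub hY
  have hYZ := hY.sub hZ
  have hXi : Integrable X P := hX.integrable one_le_two
  have hYi : Integrable (P[X | m]) P := integrable_condExp
  have hinner : Integrable (fun ω => inner ℝ ((P[X | m] - Z) ω) ((X - P[X | m]) ω)) P :=
    (hYZ.norm.integrable_mul hXY.norm).mono (hYZ.1.inner hXY.1) (ae_of_all _ fun ω => by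
      simpa using norm_inner_le_norm (𝕜 := ℝ) ((P[X | m] - Z) ω) ((X - P[X | m]) ω))
  -- Orthogonality: the first factor is `m`-measurable and comes out of the conditional expectation,
  -- while the second has conditional mean `0`.
  have horth : ∫ ω, inner ℝ ((P[X | m] - Z) ω) ((X - P[X | m]) ω) ∂P = 0 := by
    rw [← integral_condExp hm]
    have h1 := condExp_bilin_of_aestronglyMeasurable_left (m := m) (μ := P) (innerSL ℝ (E := E))
      (f := P[X | m] - Z) (g := X - P[X | m])
      (stronglyMeasurable_condExp.sub hZm).aestronglyMeasurable hinner (hXi.sub hYi)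
    have h2 : P[X - P[X | m] | m] =ᵐ[P] 0 := by
      refine (condExp_sub hXi hYi m).trans ?_
      rw [condExp_of_stronglyMeasurable hm stronglyMeasurable_condExp hYi, sub_self]
    refine integral_eq_zero_of_ae ?_
    filter_upwards [h1, h2] with ω h1 h2
    rw [h2, Pi.zero_apply, map_zero] at h1
    exact h1
  have hexp : ∀ ω, ‖X ω - Z ω‖ ^ 2 = ‖X ω - (P[X | m]) ω‖ ^ 2
      + (2 * inner ℝ ((P[X | m] - Z) ω) ((X - P[X | m]) ω) + ‖(P[X | m] - Z) ω‖ ^ 2) := by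
    intro ω
    have h := norm_add_sq_real ((X - P[X | m]) ω) ((P[X | m] - Z) ω)
    rw [real_inner_comm] at h
    simp only [Pi.sub_apply, sub_add_sub_cancel] at h ⊢
    linarith
  have i1 : Integrable (fun ω => ‖X ω - (P[X | m]) ω‖ ^ 2) P := hXY.integrable_norm_pow two_ne_zero
  have i2 : Integrable (fun ω => ‖(P[X | m] - Z) ω‖ ^ 2) P := hYZ.integrable_norm_pow two_ne_zero
  have i3 : Integrable (fun ω => 2 * inner ℝ ((P[X | m] - Z) ω) ((X - P[X | m]) ω)
      + ‖(P[X | m] - Z) ω‖ ^ 2) P := (hinner.const_mul 2).add i2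
  simp_rw [hexp]
  rw [integral_add i1 i3, integral_add (hinner.const_mul 2) i2,
    integral_const_mul, horth]
  have : 0 ≤ ∫ ω, ‖(P[X | m] - Z) ω‖ ^ 2 ∂P := integral_nonneg fun _ => by positivity
  linarith

/-- The conditional expectation is exact where the variable coincides with a measurable one. -/
theorem condExp_ae_eq_of_eq_on [IsFiniteMeasure P] {m : MeasurableSpace Ω} (hm : m ≤ m₀)
    {X g : Ω → E} {s : Set Ω} (hX : Integrable X P) (hs : MeasurableSet[m] s)
    (hg : StronglyMeasurable[m] g) (h : ∀ᵐ ω ∂P, ω ∈ s → X ω = g ω) :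
    ∀ᵐ ω ∂P, ω ∈ s → (P[X | m]) ω = X ω := by
  have h1 : s.indicator X =ᵐ[P] s.indicator g := by
    filter_upwards [h] with ω hω
    by_cases hωs : ω ∈ s
    · simp [hωs, hω hωs]
    · simp [hωs]
  -- `g` itself need not be integrable; its restriction to `s` is, because it agrees with that of
  -- `X`.
  have h2 : P[s.indicator g | m] = s.indicator g :=
    condExp_of_stronglyMeasurable hm (hg.indicator hs)
      ((integrable_congr h1).1 (hX.indicator (hm s hs)))
  have h3 := (condExp_indicator hX hs).symm.trans (condExp_congr_ae h1)
  rw [h2] at h3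
  filter_upwards [h3, h1] with ω h3 h1 hωs
  have := h3.trans h1.symm
  simpa [hωs] using this

/-- Integration of an independent variable over an event. -/
theorem setIntegral_eq_smul_of_indep [IsFiniteMeasure P] {m₁ m₂ : MeasurableSpace Ω}
    (h₁ : m₁ ≤ m₀) (h₂ : m₂ ≤ m₀) (h : Indep m₁ m₂ P) {X : Ω → E} (hX : StronglyMeasurable[m₁] X)
    (hXi : Integrable X P) {s : Set Ω} (hs : MeasurableSet[m₂] s) :
    ∫ ω in s, X ω ∂P = P.real s • ∫ ω, X ω ∂P := by
  rw [← setIntegral_condExp h₂ hXi hs,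
    setIntegral_congr_ae (g := fun _ => ∫ ω, X ω ∂P) (h₂ s hs)
      ((condExp_indep_eq h₁ h₂ hX h).mono fun ω hω _ => hω), setIntegral_const]

end Hilbert

/-! ### Moments of stable recursions -/

section Moments

variable {E : Type*} [NormedAddCommGroup E] [NormedSpace ℝ E] [FiniteDimensional ℝ E]

/-- A stable recursion with an input bounded in `L⁴` is bounded in `L⁴`. -/
theorem exists_integral_norm_pow_four_le (L : E →L[ℝ] E)
    (hL : ∀ z, Tendsto (fun k : ℕ => (L ^ k) z) atTop (𝓝 0)) {ε u : ℕ → Ω → E} {U : ℝ}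
    (h0 : MemLp (ε 0) 4 P) (hu : ∀ k, MemLp (u k) 4 P) (hU : ∀ k, ∫ ω, ‖u k ω‖ ^ 4 ∂P ≤ U)
    (h : ∀ k ω, ε (k + 1) ω = L (ε k ω) + u k ω) :
    ∃ C, ∀ k, MemLp (ε k) 4 P ∧ ∫ ω, ‖ε k ω‖ ^ 4 ∂P ≤ C := by
  have hε : ∀ k, MemLp (ε k) 4 P := by
    intro k
    induction k with
    | zero => exact h0
    | succ k ih =>
      have : ε (k + 1) = (fun ω => L (ε k ω)) + u k := funext (h k)
      rw [this]
      exact (L.comp_memLp' ih).add (hu k)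
  obtain ⟨q, ρ, C, hq, hρ0, hρ1, hC, hlow, hup, hdec⟩ := exists_lyapunov L hL
  have hq0 : ∀ x, 0 ≤ q x := fun x => (by positivity : (0 : ℝ) ≤ ‖x‖ ^ 2).trans (hlow x)
  have i4 : ∀ {f : Ω → E}, MemLp f 4 P → Integrable (fun ω => ‖f ω‖ ^ 4) P :=
    fun hf => hf.integrable_norm_pow (p := 4) (by norm_num)
  have iq : ∀ k, Integrable (fun ω => q (ε k ω) ^ 2) P := by
    intro k
    refine ((i4 (hε k)).const_mul (C ^ 2)).mono'
      ((hq.comp_aestronglyMeasurable (hε k).1).pow 2) (ae_of_all _ fun ω => ?_)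
    rw [Real.norm_of_nonneg (by positivity)]
    calc q (ε k ω) ^ 2 ≤ (C * ‖ε k ω‖ ^ 2) ^ 2 := pow_le_pow_left₀ (hq0 _) (hup _) 2
      _ = _ := by ring
  have hρ : 0 < 1 - ρ := by linarith
  have step : ∀ k, ∫ ω, q (ε (k + 1) ω) ^ 2 ∂P
      ≤ ρ * ∫ ω, q (ε k ω) ^ 2 ∂P + C ^ 2 / (1 - ρ) * U := by
    intro k
    -- The Lyapunov inequality is squared, and convexity with weights `ρ` and `1 - ρ` removes the
    -- cross term; `q ^ 2` dominates the fourth power of the norm.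
    have hpt : ∀ ω, q (ε (k + 1) ω) ^ 2 ≤ ρ * q (ε k ω) ^ 2 + C ^ 2 / (1 - ρ) * ‖u k ω‖ ^ 4 := by
      intro ω
      have h2 : q (ε (k + 1) ω) ^ 2 ≤ (ρ * q (ε k ω) + C * ‖u k ω‖ ^ 2) ^ 2 := by
        rw [h]
        exact pow_le_pow_left₀ (hq0 _) (hdec _ _) 2
      have h4 : ρ * q (ε k ω) ^ 2 + C ^ 2 / (1 - ρ) * ‖u k ω‖ ^ 4
          - (ρ * q (ε k ω) + C * ‖u k ω‖ ^ 2) ^ 2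
          = ρ * ((1 - ρ) * q (ε k ω) - C * ‖u k ω‖ ^ 2) ^ 2 / (1 - ρ) := by field_simp; ring
      have h5 : 0 ≤ ρ * ((1 - ρ) * q (ε k ω) - C * ‖u k ω‖ ^ 2) ^ 2 / (1 - ρ) := by positivity
      linarith
    have i1 := (iq k).const_mul ρ
    have i2 := (i4 (hu k)).const_mul (C ^ 2 / (1 - ρ))
    calc _ ≤ _ := integral_mono (iq (k + 1)) (i1.add i2) hpt
      _ = ρ * ∫ ω, q (ε k ω) ^ 2 ∂P + C ^ 2 / (1 - ρ) * ∫ ω, ‖u k ω‖ ^ 4 ∂P := by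
        simp only [Pi.add_apply]
        rw [integral_add i1 i2, integral_const_mul, integral_const_mul]
      _ ≤ _ := by gcongr; exact hU k
  obtain ⟨D, hD⟩ := bounded_of_le_mul_add (a := fun k => ∫ ω, q (ε k ω) ^ 2 ∂P) hρ0 hρ1 step
  refine ⟨D, fun k => ⟨hε k, (integral_mono (i4 (hε k)) (iq k) fun ω => ?_).trans (hD k)⟩⟩
  calc ‖ε k ω‖ ^ 4 = (‖ε k ω‖ ^ 2) ^ 2 := by ring
    _ ≤ _ := pow_le_pow_left₀ (by positivity) (hlow _) 2

/-- A stable recursion, possibly reset to `0`, whose input vanishes in mean square vanishes in mean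
square. -/
theorem tendsto_integral_norm_sq_of_recursion (L : E →L[ℝ] E)
    (hL : ∀ z, Tendsto (fun k : ℕ => (L ^ k) z) atTop (𝓝 0)) {X w : ℕ → Ω → E}
    (hX : ∀ k, MemLp (X k) 2 P) (hw : ∀ k, MemLp (w k) 2 P)
    (hw0 : Tendsto (fun k => ∫ ω, ‖w k ω‖ ^ 2 ∂P) atTop (𝓝 0))
    (h : ∀ k, ∀ᵐ ω ∂P, X (k + 1) ω = 0 ∨ X (k + 1) ω = L (X k ω) + w k ω) :
    Tendsto (fun k => ∫ ω, ‖X k ω‖ ^ 2 ∂P) atTop (𝓝 0) := by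
  obtain ⟨q, ρ, C, hq, hρ0, hρ1, hC, hlow, hup, hdec⟩ := exists_lyapunov L hL
  have hq0 : ∀ x, 0 ≤ q x := fun x => (by positivity : (0 : ℝ) ≤ ‖x‖ ^ 2).trans (hlow x)
  have i2 : ∀ {f : Ω → E}, MemLp f 2 P → Integrable (fun ω => ‖f ω‖ ^ 2) P :=
    fun hf => hf.integrable_norm_pow (p := 2) (by norm_num)
  have iq : ∀ k, Integrable (fun ω => q (X k ω)) P := by
    intro k
    refine ((i2 (hX k)).const_mul C).mono' (hq.comp_aestronglyMeasurable (hX k).1)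
      (ae_of_all _ fun ω => ?_)
    rw [Real.norm_of_nonneg (hq0 _)]
    exact hup _
  have step : ∀ k, ∫ ω, q (X (k + 1) ω) ∂P
      ≤ ρ * ∫ ω, q (X k ω) ∂P + C * ∫ ω, ‖w k ω‖ ^ 2 ∂P := by
    intro k
    have j1 := (iq k).const_mul ρ
    have j2 := (i2 (hw k)).const_mul C
    rw [← integral_const_mul, ← integral_const_mul, ← integral_add j1 j2]
    refine integral_mono_ae (iq (k + 1)) (j1.add j2) ?_
    filter_upwards [h k] with ω hω
    rcases hω with hω | hω
    · have h1 := hup 0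
      simp only [norm_zero, ne_eq, OfNat.ofNat_ne_zero, not_false_eq_true, zero_pow,
        mul_zero] at h1
      have h2 := mul_nonneg hρ0 (hq0 (X k ω))
      have h3 : 0 ≤ C * ‖w k ω‖ ^ 2 := by positivity
      rw [hω]
      change q 0 ≤ ρ * q (X k ω) + C * ‖w k ω‖ ^ 2
      linarith
    · rw [hω]
      exact hdec _ _
  have hlim : Tendsto (fun k => C * ∫ ω, ‖w k ω‖ ^ 2 ∂P) atTop (𝓝 0) := by
    simpa using hw0.const_mul C
  refine squeeze_zero (fun k => integral_nonneg fun _ => by positivity)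
    (fun k => integral_mono (i2 (hX k)) (iq k) fun ω => hlow _)
    (tendsto_zero_of_le_mul_add hρ0 hρ1 (fun k => integral_nonneg fun _ => hq0 _) hlim step)

end Moments

/-- The error made when a small estimate `z` of `x` is replaced by `0`. -/
theorem norm_sub_truncate_sq_le {E : Type*} [NormedAddCommGroup E] (x z : E) {M : ℝ} (hM : 0 < M)
    [Decidable (M < ‖z‖)] :
    (x = 0 → ‖x - if M < ‖z‖ then z else 0‖ ^ 2 ≤ ‖x - z‖ ^ 4 / M ^ 2) ∧
      ‖x - if M < ‖z‖ then z else 0‖ ^ 2 ≤ ‖x - z‖ ^ 4 / M ^ 2 + 3 * M ^ 2 := by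
  have h4 : 2 * ‖x - z‖ ^ 2 ≤ ‖x - z‖ ^ 4 / M ^ 2 + M ^ 2 := by
    have h5 : ‖x - z‖ ^ 4 / M ^ 2 + M ^ 2 - 2 * ‖x - z‖ ^ 2
        = (‖x - z‖ ^ 2 - M ^ 2) ^ 2 / M ^ 2 := by field_simp; ring
    have h6 : 0 ≤ (‖x - z‖ ^ 2 - M ^ 2) ^ 2 / M ^ 2 := by positivity
    linarith
  constructor
  · rintro rfl
    simp only [zero_sub, norm_neg]
    split_ifs with hz
    · rw [le_div_iff₀ (by positivity)]
      have h1 : M ^ 2 ≤ ‖z‖ ^ 2 := pow_le_pow_left₀ hM.le hz.le 2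
      calc ‖z‖ ^ 2 * M ^ 2 ≤ ‖z‖ ^ 2 * ‖z‖ ^ 2 := by gcongr
        _ = _ := by ring
    · simp only [norm_zero]
      rw [zero_pow two_ne_zero]
      positivity
  · split_ifs with hz
    · nlinarith [sq_nonneg M, sq_nonneg ‖x - z‖]
    -- Squaring gives at most `2 * ‖x - z‖ ^ 2 + 2 * M ^ 2`; then `h4` trades the first term for a
    -- fourth power plus `M ^ 2`, whence the constant `3`.
    · have h1 : ‖x - 0‖ ≤ ‖x - z‖ + M := by
        calc ‖x - 0‖ = ‖(x - z) + z‖ := by simp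
          _ ≤ _ := norm_add_le _ _
          _ ≤ _ := by gcongr; exact not_lt.1 hz
      have h2 := pow_le_pow_left₀ (norm_nonneg _) h1 2
      nlinarith [sq_nonneg (‖x - z‖ - M)]

end Measure

/-! ### The closed loop -/

section ClosedLoop

variable {n w e m : ℕ} {S : System n w e m} {Ω : Type u}

/-- The event that the remote controller has observed only zeros up to time `k`. -/
def silence (β : ℕ → Ω → ℝ) (x : ℕ → Ω → EuclideanSpace ℝ (Fin n)) (k : ℕ) : Set Ω :=
  {ω | ∀ j ≤ k, remoteObs β x j ω = 0}

/-- The information carried by the initial state, the observation noise and the packet arrivals up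
to time `k`. -/
@[reducible]
def pastInfo (x0 : Ω → EuclideanSpace ℝ (Fin n)) (v : ℕ → Ω → EuclideanSpace ℝ (Fin m))
    (β : ℕ → Ω → ℝ) (k : ℕ) : MeasurableSpace Ω :=
  MeasurableSpace.comap (fun ω => (x0 ω, fun k => v k ω)) inferInstance
    ⊔ ⨆ j ≤ k, MeasurableSpace.comap (β j) inferInstance

variable {x0 : Ω → EuclideanSpace ℝ (Fin n)} {v : ℕ → Ω → EuclideanSpace ℝ (Fin m)}
  {β : ℕ → Ω → ℝ} {x : ℕ → Ω → EuclideanSpace ℝ (Fin n)}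

theorem measurable_remoteObs {j k : ℕ} (h : j ≤ k) :
    Measurable[remoteInfo β x k] (remoteObs β x j) :=
  Measurable.of_comap_le (le_iSup₂_of_le j h le_rfl)

theorem measurable_embeddedObs {j k : ℕ} (h : j ≤ k) :
    Measurable[S.embeddedInfo β v x k] (S.embeddedObs v x j) :=
  Measurable.of_comap_le (le_sup_of_le_right (le_iSup₂_of_le j h le_rfl))

theorem remoteInfo_le_embeddedInfo (k : ℕ) : remoteInfo β x k ≤ S.embeddedInfo β v x k :=
  le_sup_left

theorem remoteInfo_mono {j k : ℕ} (h : j ≤ k) : remoteInfo β x j ≤ remoteInfo β x k :=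
  iSup₂_le fun i hi => le_iSup₂_of_le i (hi.trans h) le_rfl

theorem embeddedInfo_mono {j k : ℕ} (h : j ≤ k) :
    S.embeddedInfo β v x j ≤ S.embeddedInfo β v x k :=
  sup_le_sup (remoteInfo_mono h) (iSup₂_le fun i hi => le_iSup₂_of_le i (hi.trans h) le_rfl)

theorem pastInfo_mono {j k : ℕ} (h : j ≤ k) : pastInfo x0 v β j ≤ pastInfo x0 v β k :=
  sup_le_sup le_rfl (iSup₂_le fun i hi => le_iSup₂_of_le i (hi.trans h) le_rfl)

theorem measurable_initial_pastInfo (k : ℕ) : Measurable[pastInfo x0 v β k] x0 :=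
  measurable_fst.comp (Measurable.of_comap_le (le_sup_left (b := ⨆ j ≤ k, _)))

theorem measurable_noise_pastInfo (j k : ℕ) : Measurable[pastInfo x0 v β k] (v j) :=
  (measurable_pi_apply (X := fun _ : ℕ => EuclideanSpace ℝ (Fin m)) j).comp
    (measurable_snd.comp (Measurable.of_comap_le (f := fun ω => (x0 ω, fun k => v k ω))
      (le_sup_left (b := ⨆ j ≤ k, _))))

theorem measurable_dropout_pastInfo {j k : ℕ} (h : j ≤ k) : Measurable[pastInfo x0 v β k] (β j) :=
  Measurable.of_comap_le (le_sup_of_le_right (le_iSup₂_of_le j h le_rfl))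

theorem embeddedInfo_le_pastInfo {k : ℕ} (h : ∀ j ≤ k, Measurable[pastInfo x0 v β k] (x j)) :
    S.embeddedInfo β v x k ≤ pastInfo x0 v β k := by
  refine sup_le (iSup₂_le fun j hj => ?_) (iSup₂_le fun j hj => ?_)
  · exact Measurable.comap_le
      (Measurable.smul (measurable_dropout_pastInfo (x0 := x0) (v := v) hj) (h j hj))
  · have hH : Measurable (Matrix.toEuclideanLin S.H) :=
      (LinearMap.continuous_of_finiteDimensional _).measurable
    exact Measurable.comap_le
      (Measurable.add (hH.comp (h j hj)) (measurable_noise_pastInfo (x0 := x0) (β := β) j k))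

theorem measurableSet_silence (k : ℕ) : MeasurableSet[remoteInfo β x k] (silence β x k) := by
  have : silence β x k = ⋂ j, ⋂ (_ : j ≤ k), remoteObs β x j ⁻¹' {0} := by
    ext ω; simp [silence]
  rw [this]
  exact MeasurableSet.iInter fun j => MeasurableSet.iInter fun hj =>
    measurable_remoteObs hj (measurableSet_singleton 0)

theorem silence_anti {j k : ℕ} (h : j ≤ k) : silence β x k ⊆ silence β x j :=
  fun _ hω i hi => hω i (hi.trans h)

theorem mem_silence_succ {k : ℕ} {ω : Ω} :
    ω ∈ silence β x (k + 1) ↔ ω ∈ silence β x k ∧ remoteObs β x (k + 1) ω = 0 := by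
  refine ⟨fun h => ⟨silence_anti k.le_succ h, h _ le_rfl⟩, fun h j hj => ?_⟩
  rcases Nat.lt_or_ge j (k + 1) with hlt | hge
  · exact h.1 j (by omega)
  · obtain rfl : j = k + 1 := by omega
    exact h.2

variable [MeasurableSpace Ω] {P : Measure Ω} {LW : Matrix (Fin w ⊕ Fin e) (Fin n) ℝ}
  {LP : Matrix (Fin e) (Fin n) ℝ}

theorem System.IsClosedLoop.succ_apply (hC : S.IsClosedLoop P LW LP x0 v β x) (k : ℕ) (ω : Ω) :
    x (k + 1) ω = Matrix.toEuclideanCLM (𝕜 := ℝ) S.A (x k ω)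
      + Matrix.toEuclideanCLM (𝕜 := ℝ) (S.B * LW) (remoteEst P β x k ω)
      + Matrix.toEuclideanCLM (𝕜 := ℝ) (S.BP * LP)
          (S.embeddedEst P β v x k ω - remoteEst P β x k ω) := by
  rw [hC.2 k ω]
  have h1 : ∀ {a b c : Type} [Fintype a] [Fintype b] [Fintype c] [DecidableEq a] [DecidableEq b]
      [DecidableEq c] (M : Matrix a b ℝ) (N : Matrix b c ℝ) (z : EuclideanSpace ℝ c),
      Matrix.toEuclideanLin M (Matrix.toEuclideanLin N z) = Matrix.toEuclideanLin (M * N) z := by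
    intro a b c _ _ _ _ _ _ M N z
    simp [Matrix.toLpLin_apply]
  rw [h1, h1]
  rfl

theorem measurable_state_of_pastInfo (hC : S.IsClosedLoop P LW LP x0 v β x) {k : ℕ}
    (h : ∀ j ≤ k, Measurable[pastInfo x0 v β k] (x j)) :
    Measurable[pastInfo x0 v β k] (x (k + 1)) := by
  have hP : Measurable[pastInfo x0 v β k] (S.embeddedEst P β v x k) :=
    stronglyMeasurable_condExp.measurable.mono (embeddedInfo_le_pastInfo h) le_rfl
  have hW : Measurable[pastInfo x0 v β k] (remoteEst P β x k) :=
    stronglyMeasurable_condExp.measurable.mono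
      ((remoteInfo_le_embeddedInfo (S := S) (v := v) k).trans (embeddedInfo_le_pastInfo h)) le_rfl
  rw [funext (hC.succ_apply k)]
  exact (((ContinuousLinearMap.measurable _).comp (h k le_rfl)).add
    ((ContinuousLinearMap.measurable _).comp hW)).add
    ((ContinuousLinearMap.measurable _).comp (hP.sub hW))

theorem measurable_state_pastInfo (hC : S.IsClosedLoop P LW LP x0 v β x) (k : ℕ) :
    ∀ j ≤ k, Measurable[pastInfo x0 v β k] (x j) := by
  induction k with
  | zero =>
    intro j hj
    obtain rfl : j = 0 := by omega
    rw [hC.1]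
    exact measurable_initial_pastInfo 0
  | succ k ih =>
    intro j hj
    rcases Nat.lt_or_ge j (k + 1) with hlt | hge
    · exact (ih j (by omega)).mono (pastInfo_mono k.le_succ) le_rfl
    · obtain rfl : j = k + 1 := by omega
      exact (measurable_state_of_pastInfo hC ih).mono (pastInfo_mono k.le_succ) le_rfl

/-- The state at time `k + 1` is settled before the arrival variable `β (k + 1)` is drawn. This
one-step delay allows independence to be used at each transmission. -/
theorem measurable_state_succ_pastInfo (hC : S.IsClosedLoop P LW LP x0 v β x) (k : ℕ) :
    Measurable[pastInfo x0 v β k] (x (k + 1)) :=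
  measurable_state_of_pastInfo hC (measurable_state_pastInfo hC k)

theorem pastInfo_le (hM : S.IsRandomModel P x0 v β) (k : ℕ) :
    pastInfo x0 v β k ≤ ‹MeasurableSpace Ω› :=
  sup_le (hM.measurable_x0.prodMk (measurable_pi_lambda _ hM.measurable_v)).comap_le
    (iSup₂_le fun j _ => (hM.measurable_β j).comap_le)

theorem embeddedInfo_le (hM : S.IsRandomModel P x0 v β) (hC : S.IsClosedLoop P LW LP x0 v β x)
    (k : ℕ) : S.embeddedInfo β v x k ≤ ‹MeasurableSpace Ω› :=
  (embeddedInfo_le_pastInfo (measurable_state_pastInfo hC k)).trans (pastInfo_le hM k)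

theorem remoteInfo_le (hM : S.IsRandomModel P x0 v β) (hC : S.IsClosedLoop P LW LP x0 v β x)
    (k : ℕ) : remoteInfo β x k ≤ ‹MeasurableSpace Ω› :=
  (remoteInfo_le_embeddedInfo k).trans (embeddedInfo_le hM hC k)

theorem measurableSet_silence_ambient (hM : S.IsRandomModel P x0 v β)
    (hC : S.IsClosedLoop P LW LP x0 v β x) (k : ℕ) : MeasurableSet (silence β x k) :=
  remoteInfo_le hM hC k _ (measurableSet_silence k)

/-- The past may include the entire noise sequence, future values too, because that sequence and
`x0` are jointly independent of all packet arrivals. -/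
theorem indep_pastInfo_dropout [IsProbabilityMeasure P] (hM : S.IsRandomModel P x0 v β) (k : ℕ) :
    Indep (pastInfo x0 v β k) (MeasurableSpace.comap (β (k + 1)) inferInstance) P := by
  have hβ : ∀ j, MeasurableSpace.comap (β j) inferInstance ≤ ‹MeasurableSpace Ω› :=
    fun j => (hM.measurable_β j).comap_le
  refine indep_sup_left (hM.measurable_x0.prodMk (measurable_pi_lambda _ hM.measurable_v)).comap_le
    (iSup₂_le fun j _ => hβ j) (hβ _) ?_ ?_
  · refine indep_of_indep_of_le_right ((IndepFun_iff_Indep _ _ _).1 hM.indep_x0_v_β) ?_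
    have h : ∀ j, MeasurableSpace.comap (β j) inferInstance
        ≤ MeasurableSpace.comap (fun ω k => β k ω) inferInstance := fun j =>
      ((measurable_pi_apply j).comp (comap_measurable fun ω k => β k ω)).comap_le
    exact sup_le (iSup₂_le fun j _ => h j) (h _)
  · have h := indep_iSup_of_disjoint hβ ((iIndepFun_iff_iIndep _ _ _).1 hM.indep_β)
      (S := {j | j ≤ k}) (T := {k + 1}) (by simp)
    simpa using h

/-- Gaussian vectors have all moments; the fourth is what the truncation argument consumes. -/
theorem memLp_initial (hM : S.IsRandomModel P x0 v β) : MemLp x0 4 P := by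
  obtain ⟨μ, σ, -, h⟩ := hM.law_x0
  have := IsGaussian.memLp_id (multivariateGaussian μ σ) 4 (by norm_num)
  rw [← h.map_eq, memLp_map_measure_iff aestronglyMeasurable_id h.aemeasurable] at this
  exact this

theorem memLp_noise (hM : S.IsRandomModel P x0 v β) (k : ℕ) : MemLp (v k) 4 P := by
  have h := hM.law_v k
  have := IsGaussian.memLp_id (multivariateGaussian 0 S.Qv) 4 (by norm_num)
  rw [← h.map_eq, memLp_map_measure_iff aestronglyMeasurable_id h.aemeasurable] at this
  exact this

theorem memLp_state [IsProbabilityMeasure P] (hM : S.IsRandomModel P x0 v β)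
    (hC : S.IsClosedLoop P LW LP x0 v β x) (k : ℕ) : MemLp (x k) 2 P := by
  induction k with
  | zero =>
    rw [hC.1]
    exact (memLp_initial hM).mono_exponent (by norm_num)
  | succ k ih =>
    have hW : MemLp (remoteEst P β x k) 2 P := ih.condExp one_le_two
    have hP : MemLp (S.embeddedEst P β v x k) 2 P := ih.condExp one_le_two
    rw [funext (hC.succ_apply k)]
    have h1 := (Matrix.toEuclideanCLM (𝕜 := ℝ) S.A).comp_memLp' ih
    have h2 := (Matrix.toEuclideanCLM (𝕜 := ℝ) (S.B * LW)).comp_memLp' hW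
    have h3 := (Matrix.toEuclideanCLM (𝕜 := ℝ) (S.BP * LP)).comp_memLp' (hP.sub hW)
    exact (h1.add h2).add h3

theorem dropout_ae_eq_zero_or_one [IsProbabilityMeasure P] (hM : S.IsRandomModel P x0 v β) (k : ℕ) :
    ∀ᵐ ω ∂P, β k ω = 0 ∨ β k ω = 1 := by
  have h0 : MeasurableSet {ω | β k ω = 0} := hM.measurable_β k (measurableSet_singleton 0)
  have h1 : MeasurableSet {ω | β k ω = 1} := hM.measurable_β k (measurableSet_singleton 1)
  have hdisj : Disjoint {ω | β k ω = 0} {ω | β k ω = 1} := by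
    rw [Set.disjoint_left]
    intro ω h h'
    simp only [Set.mem_ofPred_eq] at h h'
    linarith
  have h : P.real ({ω | β k ω = 0} ∪ {ω | β k ω = 1}) = 1 := by
    rw [measureReal_union hdisj h1, hM.dropout, hM.success]
    ring
  have h2 : P ({ω | β k ω = 0} ∪ {ω | β k ω = 1}) = 1 := by
    rw [← ENNReal.toReal_eq_one_iff]
    exact h
  exact (prob_compl_eq_zero_iff (h0.union h1)).2 h2

end ClosedLoop

section Analysis

variable {n w e m : ℕ} {S : System n w e m} {Ω : Type u} [MeasurableSpace Ω] {P : Measure Ω}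
  [IsProbabilityMeasure P] {LW : Matrix (Fin w ⊕ Fin e) (Fin n) ℝ} {LP : Matrix (Fin e) (Fin n) ℝ}
  {x0 : Ω → EuclideanSpace ℝ (Fin n)} {v : ℕ → Ω → EuclideanSpace ℝ (Fin m)}
  {β : ℕ → Ω → ℝ} {x : ℕ → Ω → EuclideanSpace ℝ (Fin n)}

/-! ### The estimates after the first nonzero packet -/

theorem ests_eq_of_state_eq_measurable (hM : S.IsRandomModel P x0 v β)
    (hC : S.IsClosedLoop P LW LP x0 v β x) {k : ℕ} {g : Ω → EuclideanSpace ℝ (Fin n)}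
    (hg : Measurable[remoteInfo β x k] g)
    (h : ∀ᵐ ω ∂P, ω ∈ (silence β x k)ᶜ → x k ω = g ω) :
    ∀ᵐ ω ∂P, ω ∈ (silence β x k)ᶜ →
      remoteEst P β x k ω = x k ω ∧ S.embeddedEst P β v x k ω = x k ω := by
  have hX : Integrable (x k) P := (memLp_state hM hC k).integrable one_le_two
  have hs : MeasurableSet[remoteInfo β x k] (silence β x k)ᶜ := (measurableSet_silence k).compl
  have hle := remoteInfo_le_embeddedInfo (S := S) (β := β) (v := v) (x := x) k
  have h1 := condExp_ae_eq_of_eq_on (remoteInfo_le hM hC k) hX hs hg.stronglyMeasurable h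
  have h2 := condExp_ae_eq_of_eq_on (embeddedInfo_le hM hC k) hX (hle _ hs)
    (hg.stronglyMeasurable.mono hle) h
  filter_upwards [h1, h2] with ω h1 h2 hω
  exact ⟨h1 hω, h2 hω⟩

theorem exists_measurable_eq_state (hM : S.IsRandomModel P x0 v β)
    (hC : S.IsClosedLoop P LW LP x0 v β x) (k : ℕ) :
    ∃ g : Ω → EuclideanSpace ℝ (Fin n), Measurable[remoteInfo β x k] g ∧
      ∀ᵐ ω ∂P, ω ∈ (silence β x k)ᶜ → x k ω = g ω := by
  have hobs : ∀ j, ∀ᵐ ω ∂P, remoteObs β x j ω ≠ 0 → x j ω = remoteObs β x j ω := by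
    intro j
    filter_upwards [dropout_ae_eq_zero_or_one hM j] with ω hω h
    rcases hω with h0 | h1
    · exact absurd (by simp [remoteObs, h0]) h
    · simp [remoteObs, h1]
  induction k with
  | zero =>
    refine ⟨remoteObs β x 0, measurable_remoteObs le_rfl, ?_⟩
    filter_upwards [hobs 0] with ω h hω
    refine h fun h0 => hω fun j hj => ?_
    obtain rfl : j = 0 := by omega
    exact h0
  | succ k ih =>
    obtain ⟨g, hg, hxg⟩ := ih
    have hest := ests_eq_of_state_eq_measurable hM hC hg hxg
    let F := Matrix.toEuclideanCLM (𝕜 := ℝ) S.A + Matrix.toEuclideanCLM (𝕜 := ℝ) (S.B * LW)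
    classical
    -- A nonzero packet displays the state itself. After a zero packet, silence was broken earlier,
    -- so both estimates at time `k` are exact and the known state moves by `F`.
    refine ⟨fun ω => if remoteObs β x (k + 1) ω = 0 then F (g ω) else remoteObs β x (k + 1) ω,
      ?_, ?_⟩
    · have hy : Measurable[remoteInfo β x (k + 1)] (remoteObs β x (k + 1)) :=
        measurable_remoteObs le_rfl
      exact Measurable.ite (hy (measurableSet_singleton 0))
        (F.measurable.comp (hg.mono (remoteInfo_mono k.le_succ) le_rfl)) hy
    · filter_upwards [hobs (k + 1), hxg, hest] with ω h1 h2 h3 hω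
      split_ifs with h0
      · have hωk : ω ∈ (silence β x k)ᶜ := fun h => hω (mem_silence_succ.2 ⟨h, h0⟩)
        obtain ⟨h4, h5⟩ := h3 hωk
        rw [hC.succ_apply, h4, h5, sub_self, map_zero, add_zero, ← h2 hωk]
        rfl
      · exact h1 h0

/-- Once a nonzero packet has arrived, both controllers know the state. -/
theorem ests_eq_state (hM : S.IsRandomModel P x0 v β) (hC : S.IsClosedLoop P LW LP x0 v β x)
    (k : ℕ) : ∀ᵐ ω ∂P, ω ∈ (silence β x k)ᶜ →
      remoteEst P β x k ω = x k ω ∧ S.embeddedEst P β v x k ω = x k ω := by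
  obtain ⟨g, hg, h⟩ := exists_measurable_eq_state hM hC k
  exact ests_eq_of_state_eq_measurable hM hC hg h

/-! ### The remote estimate during silence -/

/-- The mean of the state given that only zeros have been observed. -/
noncomputable def silentMean (P : Measure Ω) (β : ℕ → Ω → ℝ)
    (x : ℕ → Ω → EuclideanSpace ℝ (Fin n)) (k : ℕ) : EuclideanSpace ℝ (Fin n) :=
  (P.real (silence β x k))⁻¹ • ∫ ω in silence β x k, x k ω ∂P

/-- All outcomes in the silence event give the remote controller the same data, so its estimate is
constant there. The constant is identified by integrating over the event, which is itself
observable. -/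
theorem remoteEst_eq_silentMean (hM : S.IsRandomModel P x0 v β)
    (hC : S.IsClosedLoop P LW LP x0 v β x) (k : ℕ) :
    ∀ᵐ ω ∂P, ω ∈ silence β x k → remoteEst P β x k ω = silentMean P β x k := by
  by_cases h0 : P.real (silence β x k) = 0
  · have : P (silence β x k) = 0 := (measureReal_eq_zero_iff).1 h0
    filter_upwards [measure_eq_zero_iff_ae_notMem.1 this] with ω hω h
    exact absurd h hω
  · refine ae_of_all _ fun ω hω => ?_
    have hconst : ∀ ω' ∈ silence β x k, remoteEst P β x k ω' = remoteEst P β x k ω := by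
      intro ω' hω'
      refine eq_of_stronglyMeasurable_iSup_comap (Y := remoteObs β x) (k := k)
        stronglyMeasurable_condExp fun j hj => ?_
      rw [hω j hj, hω' j hj]
    have h1 : ∫ ω' in silence β x k, remoteEst P β x k ω' ∂P
        = P.real (silence β x k) • remoteEst P β x k ω := by
      rw [setIntegral_congr_fun (measurableSet_silence_ambient hM hC k) hconst, setIntegral_const]
    have h2 : ∫ ω' in silence β x k, remoteEst P β x k ω' ∂P = ∫ ω' in silence β x k, x k ω' ∂P :=
      setIntegral_condExp (remoteInfo_le hM hC k) ((memLp_state hM hC k).integrable one_le_two)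
        (measurableSet_silence k)
    rw [silentMean, ← h2, h1, inv_smul_smul₀ h0]

/-- A packet is lost with probability `p`, independently of the past. -/
theorem setIntegral_state_silence_succ (hM : S.IsRandomModel P x0 v β)
    (hC : S.IsClosedLoop P LW LP x0 v β x) (k : ℕ) :
    ∫ ω in silence β x (k + 1), x (k + 1) ω ∂P
      = S.p • ∫ ω in silence β x k, x (k + 1) ω ∂P := by
  have hsub : silence β x k ∩ {ω | β (k + 1) ω = 0} ⊆ silence β x (k + 1) := by
    rintro ω ⟨h1, h2⟩
    have h2' : β (k + 1) ω = 0 := h2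
    exact mem_silence_succ.2 ⟨h1, by simp [remoteObs, h2']⟩
  have hβ : MeasurableSet[MeasurableSpace.comap (β (k + 1)) inferInstance]
      {ω | β (k + 1) ω = 0} := ⟨{0}, measurableSet_singleton 0, rfl⟩
  have hβ' : MeasurableSet {ω | β (k + 1) ω = 0} :=
    hM.measurable_β _ (measurableSet_singleton 0)
  have hE := measurableSet_silence_ambient hM hC k
  have hle := (remoteInfo_le_embeddedInfo (S := S) (v := v) k).trans
    (embeddedInfo_le_pastInfo (measurable_state_pastInfo hC k))
  -- Silence can also continue with a nonzero `β (k + 1)`, but only where `x (k + 1)` is `0`, so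
  -- these outcomes do not affect the integral.
  rw [setIntegral_eq_of_subset_of_forall_sdiff_eq_zero (measurableSet_silence_ambient hM hC (k + 1)) hsub,
    ← hM.dropout (k + 1), Set.inter_comm, ← integral_indicator (hβ'.inter hE),
    ← Set.indicator_indicator, integral_indicator hβ',
    setIntegral_eq_smul_of_indep (pastInfo_le hM k) ((hM.measurable_β (k + 1)).comap_le)
      (indep_pastInfo_dropout hM k)
      ((measurable_state_succ_pastInfo hC k).stronglyMeasurable.indicator
        (hle _ (measurableSet_silence k)))
      (((memLp_state hM hC (k + 1)).integrable one_le_two).indicator hE) hβ,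
    integral_indicator hE]
  rintro ω ⟨h1, h2⟩
  obtain ⟨h3, h4⟩ := mem_silence_succ.1 h1
  exact (smul_eq_zero.1 h4).resolve_left fun h0 => h2 ⟨h3, h0⟩

/-- The mean of the state propagates through `A + B L^W` during silence. -/
theorem setIntegral_state_silence (hM : S.IsRandomModel P x0 v β)
    (hC : S.IsClosedLoop P LW LP x0 v β x) (k : ℕ) :
    ∫ ω in silence β x k, x (k + 1) ω ∂P
      = Matrix.toEuclideanCLM (𝕜 := ℝ) (S.A + S.B * LW) (∫ ω in silence β x k, x k ω ∂P) := by
  have hX : Integrable (x k) P := (memLp_state hM hC k).integrable one_le_two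
  have hW : Integrable (remoteEst P β x k) P := integrable_condExp
  have hP : Integrable (S.embeddedEst P β v x k) P := integrable_condExp
  -- The silence event lies in both information σ-algebras, so both estimates integrate to the same
  -- value over it and the term with `LP` cancels.
  have eW : ∫ ω in silence β x k, remoteEst P β x k ω ∂P = ∫ ω in silence β x k, x k ω ∂P :=
    setIntegral_condExp (remoteInfo_le hM hC k) hX (measurableSet_silence k)
  have eP : ∫ ω in silence β x k, S.embeddedEst P β v x k ω ∂P = ∫ ω in silence β x k, x k ω ∂P :=
    setIntegral_condExp (embeddedInfo_le hM hC k) hX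
      (remoteInfo_le_embeddedInfo k _ (measurableSet_silence k))
  have j1 := (Matrix.toEuclideanCLM (𝕜 := ℝ) S.A).integrable_comp (hX.restrict (s := silence β x k))
  have j2 := (Matrix.toEuclideanCLM (𝕜 := ℝ) (S.B * LW)).integrable_comp
    (hW.restrict (s := silence β x k))
  have hPW : Integrable (fun ω => S.embeddedEst P β v x k ω - remoteEst P β x k ω)
      (P.restrict (silence β x k)) := hP.restrict.sub hW.restrict
  have j3 := (Matrix.toEuclideanCLM (𝕜 := ℝ) (S.BP * LP)).integrable_comp hPW
  simp only [hC.succ_apply]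
  have j12 : Integrable (fun ω => Matrix.toEuclideanCLM (𝕜 := ℝ) S.A (x k ω)
      + Matrix.toEuclideanCLM (𝕜 := ℝ) (S.B * LW) (remoteEst P β x k ω))
      (P.restrict (silence β x k)) := j1.add j2
  rw [integral_add j12 j3, integral_add j1 j2, ContinuousLinearMap.integral_comp_comm _ hX.restrict,
    ContinuousLinearMap.integral_comp_comm _ hW.restrict,
    ContinuousLinearMap.integral_comp_comm _ hPW,
    integral_sub hP.restrict hW.restrict, eW, eP, sub_self, map_zero, add_zero, map_add]
  rfl

/-- A lost packet prolongs silence. Equality can fail, since a zero state prolongs it as well. -/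
theorem real_silence_succ_ge (hM : S.IsRandomModel P x0 v β)
    (hC : S.IsClosedLoop P LW LP x0 v β x) (k : ℕ) :
    S.p * P.real (silence β x k) ≤ P.real (silence β x (k + 1)) := by
  have hle := (remoteInfo_le_embeddedInfo (S := S) (v := v) k).trans
    (embeddedInfo_le_pastInfo (measurable_state_pastInfo hC k))
  have h := (Indep_iff _ _ _).1 (indep_pastInfo_dropout hM k) (silence β x k)
    {ω | β (k + 1) ω = 0} (hle _ (measurableSet_silence k)) ⟨{0}, measurableSet_singleton 0, rfl⟩
  have h' : P.real (silence β x k ∩ {ω | β (k + 1) ω = 0}) = P.real (silence β x k) * S.p := by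
    rw [measureReal_def, h, ENNReal.toReal_mul, ← hM.dropout (k + 1)]
    rfl
  rw [mul_comm, ← h']
  refine measureReal_mono ?_
  rintro ω ⟨h1, h2⟩
  have h2' : β (k + 1) ω = 0 := h2
  exact mem_silence_succ.2 ⟨h1, by simp [remoteObs, h2']⟩

theorem exists_silentMean_succ (hp0 : 0 ≤ S.p) (hM : S.IsRandomModel P x0 v β)
    (hC : S.IsClosedLoop P LW LP x0 v β x) (k : ℕ) :
    ∃ r : ℝ, 0 ≤ r ∧ r ≤ 1 ∧ silentMean P β x (k + 1)
      = r • Matrix.toEuclideanCLM (𝕜 := ℝ) (S.A + S.B * LW) (silentMean P β x k) := by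
  by_cases h0 : P.real (silence β x (k + 1)) = 0
  -- On a null event `silentMean` is `0`, because the inverse of `0` is `0`.
  · exact ⟨0, le_rfl, zero_le_one, by simp [silentMean, h0]⟩
  have hpos : 0 < P.real (silence β x (k + 1)) := lt_of_le_of_ne measureReal_nonneg (Ne.symm h0)
  have hpos' : 0 < P.real (silence β x k) :=
    hpos.trans_le (measureReal_mono (silence_anti k.le_succ))
  refine ⟨S.p * P.real (silence β x k) / P.real (silence β x (k + 1)), by positivity,
    (div_le_one hpos).2 (real_silence_succ_ge hM hC k), ?_⟩
  rw [silentMean, setIntegral_state_silence_succ hM hC, setIntegral_state_silence hM hC, silentMean,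
    map_smul, smul_smul, smul_smul]
  congr 1
  field_simp

theorem tendsto_silentMean (hp0 : 0 ≤ S.p) (hF : IsStable (S.A + S.B * LW))
    (hM : S.IsRandomModel P x0 v β) (hC : S.IsClosedLoop P LW LP x0 v β x) :
    Tendsto (fun k => ‖silentMean P β x k‖) atTop (𝓝 0) := by
  have h : ∀ k, ∃ t : ℝ, 0 ≤ t ∧ t ≤ 1 ∧ silentMean P β x k
      = t • (Matrix.toEuclideanCLM (𝕜 := ℝ) (S.A + S.B * LW) ^ k) (silentMean P β x 0) := by
    intro k
    induction k with
    | zero => exact ⟨1, zero_le_one, le_rfl, by simp⟩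
    | succ k ih =>
      obtain ⟨t, ht0, ht1, ht⟩ := ih
      obtain ⟨r, hr0, hr1, hr⟩ := exists_silentMean_succ hp0 hM hC k
      refine ⟨r * t, mul_nonneg hr0 ht0, mul_le_one₀ hr1 ht0 ht1, ?_⟩
      rw [hr, ht, map_smul, smul_smul, pow_succ']
      rfl
  have hlim := (hF.tendsto_toEuclideanCLM (silentMean P β x 0)).norm
  rw [norm_zero] at hlim
  refine squeeze_zero (fun k => norm_nonneg _) (fun k => ?_) hlim
  obtain ⟨t, ht0, ht1, ht⟩ := h k
  rw [ht, norm_smul, Real.norm_of_nonneg ht0]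
  exact mul_le_of_le_one_left (norm_nonneg _) ht1

/-! ### A nonzero state does not stay unobserved -/

/-- The probabilities of silence decrease to a limit, so their successive differences vanish. Such a
difference is at least `1 - S.p` times the probability that silence has lasted up to `k` and `x (k +
1)` is nonzero, since a packet arriving then breaks silence. -/
theorem tendsto_real_silence_ne_zero (hp1 : S.p < 1) (hM : S.IsRandomModel P x0 v β)
    (hC : S.IsClosedLoop P LW LP x0 v β x) :
    Tendsto (fun k => P.real (silence β x k ∩ {ω | x k ω ≠ 0})) atTop (𝓝 0) := by
  have hanti : Antitone fun k => P.real (silence β x k) :=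
    fun j k h => measureReal_mono (silence_anti h)
  have hconv := tendsto_atTop_ciInf hanti ⟨0, by rintro _ ⟨k, rfl⟩; exact measureReal_nonneg⟩
  have hdiff : Tendsto (fun k => P.real (silence β x k) - P.real (silence β x (k + 1))) atTop
      (𝓝 0) := by
    simpa using hconv.sub (hconv.comp (tendsto_add_atTop_nat 1))
  have hq : 0 < 1 - S.p := by linarith
  have hlim : Tendsto (fun k => (1 - S.p)⁻¹
      * (P.real (silence β x k) - P.real (silence β x (k + 1)))) atTop (𝓝 0) := by
    simpa using hdiff.const_mul (1 - S.p)⁻¹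
  rw [← tendsto_add_atTop_iff_nat 1]
  refine squeeze_zero (fun k => measureReal_nonneg) (fun k => ?_) hlim
  have hle := (remoteInfo_le_embeddedInfo (S := S) (v := v) k).trans
    (embeddedInfo_le_pastInfo (measurable_state_pastInfo hC k))
  have hx : MeasurableSet[pastInfo x0 v β k] {ω | x (k + 1) ω ≠ 0} :=
    measurable_state_succ_pastInfo hC k (measurableSet_singleton 0).compl
  have h := (Indep_iff _ _ _).1 (indep_pastInfo_dropout hM k)
    (silence β x k ∩ {ω | x (k + 1) ω ≠ 0}) {ω | β (k + 1) ω = 1}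
    (MeasurableSet.inter (hle _ (measurableSet_silence k)) hx) ⟨{1}, measurableSet_singleton 1, rfl⟩
  have h' : P.real (silence β x k ∩ {ω | x (k + 1) ω ≠ 0} ∩ {ω | β (k + 1) ω = 1})
      = P.real (silence β x k ∩ {ω | x (k + 1) ω ≠ 0}) * (1 - S.p) := by
    rw [measureReal_def, h, ENNReal.toReal_mul, ← hM.success (k + 1)]
    rfl
  rw [inv_mul_eq_div, le_div_iff₀ hq, ← measureReal_sdiff (silence_anti k.le_succ)
    (measurableSet_silence_ambient hM hC (k + 1))]
  refine (mul_le_mul_of_nonneg_right (measureReal_mono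
    (Set.inter_subset_inter_left _ (silence_anti k.le_succ))) hq.le).trans ?_
  rw [← h']
  refine measureReal_mono ?_
  rintro ω ⟨⟨h1, h2⟩, h3⟩
  refine ⟨h1, fun h4 => h2 ?_⟩
  have h5 := (mem_silence_succ.1 h4).2
  have h3' : β (k + 1) ω = 1 := h3
  simpa [remoteObs, h3'] using h5

end Analysis

/-! ### Truncated estimates and mean-square inequalities -/

section Integral

variable {Ω : Type*} {m₀ : MeasurableSpace Ω} {P : Measure Ω}
  {E : Type*} [NormedAddCommGroup E]

open Classical in
/-- The estimate `z` where its norm exceeds `M`, and `0` elsewhere. -/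
noncomputable def truncate (M : ℝ) (z : Ω → E) : Ω → E :=
  fun ω => if M < ‖z ω‖ then z ω else 0

theorem measurable_truncate {m : MeasurableSpace Ω} [MeasurableSpace E] [BorelSpace E] {M : ℝ}
    {z : Ω → E} (hz : Measurable[m] z) : Measurable[m] (truncate M z) :=
  Measurable.ite (measurableSet_lt measurable_const hz.norm) hz measurable_const

theorem memLp_truncate [MeasurableSpace E] [BorelSpace E] [SecondCountableTopology E] {M : ℝ}
    {X z : Ω → E} {p : ENNReal} (hz : Measurable z) (hX : MemLp X p P)
    (h : MemLp (fun ω => X ω - z ω) p P) : MemLp (truncate M z) p P := by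
  have hz2 : MemLp z p P := by
    have : z = X - fun ω => X ω - z ω := by funext ω; simp
    rw [this]
    exact hX.sub h
  refine hz2.mono (measurable_truncate hz).aestronglyMeasurable (ae_of_all _ fun ω => ?_)
  unfold truncate
  split_ifs
  · exact le_rfl
  · simp

theorem integral_norm_indicator_sub_truncate_sq_le [IsProbabilityMeasure P] [MeasurableSpace E]
    [BorelSpace E] {M : ℝ} {X z : Ω → E} (hX : MemLp X 2 P) (hXm : Measurable X)
    (hζ : MemLp (truncate M z) 2 P) (h4 : MemLp (fun ω => X ω - z ω) 4 P) {s : Set Ω}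
    (hs : MeasurableSet s) (hM : 0 < M) :
    ∫ ω, ‖s.indicator X ω - s.indicator (truncate M z) ω‖ ^ 2 ∂P
      ≤ (∫ ω, ‖X ω - z ω‖ ^ 4 ∂P) / M ^ 2 + 3 * M ^ 2 * P.real (s ∩ {ω | X ω ≠ 0}) := by
  classical
  have hS : MeasurableSet (s ∩ {ω | X ω ≠ 0}) := hs.inter (hXm (measurableSet_singleton 0).compl)
  have i4 : Integrable (fun ω => ‖X ω - z ω‖ ^ 4 / M ^ 2) P :=
    (h4.integrable_norm_pow (p := 4) (by norm_num)).div_const _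
  have i0 : Integrable ((s ∩ {ω | X ω ≠ 0}).indicator fun _ => 3 * M ^ 2) P :=
    (integrable_const _).indicator hS
  have i2 : Integrable (fun ω => ‖s.indicator X ω - s.indicator (truncate M z) ω‖ ^ 2) P :=
    ((hX.indicator hs).sub (hζ.indicator hs)).integrable_norm_pow (p := 2) (by norm_num)
  calc _ ≤ ∫ ω, (‖X ω - z ω‖ ^ 4 / M ^ 2
        + (s ∩ {ω | X ω ≠ 0}).indicator (fun _ => 3 * M ^ 2) ω) ∂P := by
        refine integral_mono i2 (i4.add i0) fun ω => ?_
        obtain ⟨h1, h2⟩ := norm_sub_truncate_sq_le (X ω) (z ω) hM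
        change _ ≤ ‖X ω - z ω‖ ^ 4 / M ^ 2
          + (s ∩ {ω | X ω ≠ 0}).indicator (fun _ => 3 * M ^ 2) ω
        by_cases h : ω ∈ s
        · rw [Set.indicator_of_mem h, Set.indicator_of_mem h]
          by_cases hx : X ω = 0
          · rw [Set.indicator_of_notMem fun h' => h'.2 hx, add_zero]
            exact h1 hx
          · rw [Set.indicator_of_mem (show ω ∈ s ∩ {ω | X ω ≠ 0} from ⟨h, hx⟩)]
            exact h2
        · rw [Set.indicator_of_notMem h, Set.indicator_of_notMem h,
            Set.indicator_of_notMem fun h' => h h'.1, sub_self, norm_zero, zero_pow two_ne_zero,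
            add_zero]
          positivity
    _ = _ := by
        rw [integral_add i4 i0, integral_div, integral_indicator hS, setIntegral_const, smul_eq_mul,
          mul_comm (P.real _)]

/-- The conditional expectation beats the truncation of any estimate with finite fourth moment. -/
theorem integral_indicator_sub_condExp_sq_le [IsProbabilityMeasure P] {F : Type*}
    [NormedAddCommGroup F] [InnerProductSpace ℝ F] [CompleteSpace F] [MeasurableSpace F]
    [BorelSpace F] [SecondCountableTopology F] {m : MeasurableSpace Ω} (hm : m ≤ m₀) {M : ℝ}
    {X z : Ω → F} (hX : MemLp X 2 P) (hXm : Measurable[m₀] X) (hz : Measurable[m] z)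
    (h4 : MemLp (fun ω => X ω - z ω) 4 P) {s : Set Ω} (hs : MeasurableSet[m] s) (hM : 0 < M) :
    ∫ ω, ‖s.indicator (fun ω => X ω - (P[X | m]) ω) ω‖ ^ 2 ∂P
      ≤ (∫ ω, ‖X ω - z ω‖ ^ 4 ∂P) / M ^ 2 + 3 * M ^ 2 * P.real (s ∩ {ω | X ω ≠ 0}) := by
  have hζ : MemLp (truncate M z) 2 P :=
    memLp_truncate (hz.mono hm le_rfl) hX (h4.mono_exponent (by norm_num))
  have hζm : StronglyMeasurable[m] (truncate M z) := (measurable_truncate hz).stronglyMeasurable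
  have hs₀ : MeasurableSet[m₀] s := hm s hs
  have hX' : MemLp (s.indicator X) 2 P := hX.indicator hs₀
  have hζ' : MemLp (s.indicator (truncate M z)) 2 P := hζ.indicator hs₀
  have hζm' : StronglyMeasurable[m] (s.indicator (truncate M z)) := hζm.indicator hs
  have hbest := integral_norm_sub_condExp_sq_le hm hX' hζ' hζm'
  -- As `s` is `m`-measurable, restriction to `s` commutes with conditioning, so the
  -- best-approximation property can be applied to the restricted variable.
  have heq : ∫ ω, ‖s.indicator (fun ω => X ω - (P[X | m]) ω) ω‖ ^ 2 ∂P
      = ∫ ω, ‖s.indicator X ω - (P[s.indicator X | m]) ω‖ ^ 2 ∂P := by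
    refine integral_congr_ae ?_
    filter_upwards [condExp_indicator (hX.integrable one_le_two) hs] with ω hω
    rw [hω]
    by_cases h : ω ∈ s
    · simp only [Set.indicator_of_mem h]
    · simp only [Set.indicator_of_notMem h, sub_zero]
  rw [heq]
  exact hbest.trans (integral_norm_indicator_sub_truncate_sq_le hX hXm hζ h4 hs₀ hM)

theorem integral_norm_add_sq_le {f g : Ω → E}
    (hf : MemLp f 2 P) (hg : MemLp g 2 P) :
    ∫ ω, ‖f ω + g ω‖ ^ 2 ∂P ≤ 2 * ∫ ω, ‖f ω‖ ^ 2 ∂P + 2 * ∫ ω, ‖g ω‖ ^ 2 ∂P := by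
  have i1 := hf.integrable_norm_pow (p := 2) (by norm_num)
  have i2 := hg.integrable_norm_pow (p := 2) (by norm_num)
  rw [← integral_const_mul, ← integral_const_mul,
    ← integral_add (i1.const_mul 2) (i2.const_mul 2)]
  refine integral_mono ((hf.add hg).integrable_norm_pow (p := 2) (by norm_num))
    ((i1.const_mul 2).add (i2.const_mul 2)) fun ω => ?_
  have h := pow_le_pow_left₀ (norm_nonneg _) (norm_add_le (f ω) (g ω)) 2
  change ‖f ω + g ω‖ ^ 2 ≤ 2 * ‖f ω‖ ^ 2 + 2 * ‖g ω‖ ^ 2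
  nlinarith [sq_nonneg (‖f ω‖ - ‖g ω‖)]

theorem integral_norm_clm_sq_le [NormedSpace ℝ E]
    (T : E →L[ℝ] E) {f : Ω → E} (hf : MemLp f 2 P) :
    ∫ ω, ‖T (f ω)‖ ^ 2 ∂P ≤ ‖T‖ ^ 2 * ∫ ω, ‖f ω‖ ^ 2 ∂P := by
  have i1 := hf.integrable_norm_pow (p := 2) (by norm_num)
  rw [← integral_const_mul]
  refine integral_mono ((T.comp_memLp' hf).integrable_norm_pow (p := 2) (by norm_num))
    (i1.const_mul _) fun ω => ?_
  have h := pow_le_pow_left₀ (norm_nonneg _) (T.le_opNorm (f ω)) 2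
  rwa [mul_pow] at h

end Integral

section Convergence

variable {n w e m : ℕ} {S : System n w e m} {Ω : Type u} [MeasurableSpace Ω] {P : Measure Ω}
  {LW : Matrix (Fin w ⊕ Fin e) (Fin n) ℝ} {LP : Matrix (Fin e) (Fin n) ℝ}
  {x0 : Ω → EuclideanSpace ℝ (Fin n)} {v : ℕ → Ω → EuclideanSpace ℝ (Fin m)}
  {β : ℕ → Ω → ℝ} {x : ℕ → Ω → EuclideanSpace ℝ (Fin n)}

/-! ### The estimation error during silence -/

/-- The observer with injection gain `K`, run by the embedded controller. -/
noncomputable def System.observer (S : System n w e m) (P : Measure Ω)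
    (LW : Matrix (Fin w ⊕ Fin e) (Fin n) ℝ) (LP : Matrix (Fin e) (Fin n) ℝ)
    (K : Matrix (Fin n) (Fin m) ℝ) (v : ℕ → Ω → EuclideanSpace ℝ (Fin m)) (β : ℕ → Ω → ℝ)
    (x : ℕ → Ω → EuclideanSpace ℝ (Fin n)) : ℕ → Ω → EuclideanSpace ℝ (Fin n)
  -- Starting from `0` makes the initial error equal to `x0`.
  | 0 => fun _ => 0
  | k + 1 => fun ω => Matrix.toEuclideanCLM (𝕜 := ℝ) (S.A + K * S.H)
        (System.observer S P LW LP K v β x k ω)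
      - Matrix.toEuclideanLin K (S.embeddedObs v x k ω)
      + Matrix.toEuclideanCLM (𝕜 := ℝ) (S.B * LW) (remoteEst P β x k ω)
      + Matrix.toEuclideanCLM (𝕜 := ℝ) (S.BP * LP)
          (S.embeddedEst P β v x k ω - remoteEst P β x k ω)

theorem measurable_observer (K : Matrix (Fin n) (Fin m) ℝ) (k : ℕ) :
    Measurable[S.embeddedInfo β v x k] (S.observer P LW LP K v β x k) := by
  induction k with
  | zero => exact measurable_const
  | succ k ih =>
    have hle := embeddedInfo_mono (S := S) (β := β) (v := v) (x := x) k.le_succ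
    have hP : Measurable[S.embeddedInfo β v x (k + 1)] (S.embeddedEst P β v x k) :=
      stronglyMeasurable_condExp.measurable.mono hle le_rfl
    have hW : Measurable[S.embeddedInfo β v x (k + 1)] (remoteEst P β x k) :=
      stronglyMeasurable_condExp.measurable.mono
        ((remoteInfo_le_embeddedInfo (S := S) (v := v) k).trans hle) le_rfl
    have hK : Measurable (Matrix.toEuclideanLin K) :=
      (LinearMap.continuous_of_finiteDimensional _).measurable
    exact (((((ContinuousLinearMap.measurable _).comp (ih.mono hle le_rfl))).sub
      (hK.comp (measurable_embeddedObs k.le_succ))).add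
      ((ContinuousLinearMap.measurable _).comp hW)).add
      ((ContinuousLinearMap.measurable _).comp (hP.sub hW))

/-- The observer applies the same inputs as the plant, so they cancel: the error is driven by the
noise alone, whatever the feedback gains. -/
theorem observer_error_succ (hC : S.IsClosedLoop P LW LP x0 v β x) (K : Matrix (Fin n) (Fin m) ℝ)
    (k : ℕ) (ω : Ω) :
    x (k + 1) ω - S.observer P LW LP K v β x (k + 1) ω
      = Matrix.toEuclideanCLM (𝕜 := ℝ) (S.A + K * S.H)
          (x k ω - S.observer P LW LP K v β x k ω) + Matrix.toEuclideanLin K (v k ω) := by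
  have h1 : Matrix.toEuclideanCLM (𝕜 := ℝ) (S.A + K * S.H) (x k ω)
      = Matrix.toEuclideanCLM (𝕜 := ℝ) S.A (x k ω)
        + Matrix.toEuclideanLin K (Matrix.toEuclideanLin S.H (x k ω)) := by
    rw [map_add]
    apply (WithLp.equiv 2 _).injective
    simp [Matrix.toLpLin_apply]
  rw [hC.succ_apply, map_sub (Matrix.toEuclideanCLM (𝕜 := ℝ) (S.A + K * S.H)), h1]
  simp only [System.observer, System.embeddedObs, map_add (Matrix.toEuclideanLin K)]
  abel

theorem exists_observer_error_bound {K : Matrix (Fin n) (Fin m) ℝ} (hK : IsStable (S.A + K * S.H))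
    (hM : S.IsRandomModel P x0 v β) (hC : S.IsClosedLoop P LW LP x0 v β x) :
    ∃ C, ∀ k, MemLp (fun ω => x k ω - S.observer P LW LP K v β x k ω) 4 P ∧
      ∫ ω, ‖x k ω - S.observer P LW LP K v β x k ω‖ ^ 4 ∂P ≤ C := by
  let T := (Matrix.toEuclideanLin K).toContinuousLinearMap
  have hT : ∀ k, MemLp (fun ω => T (v k ω)) 4 P := fun k => T.comp_memLp' (memLp_noise hM k)
  refine exists_integral_norm_pow_four_le
    -- The noise variables share one law, so a single constant bounds all their fourth moments.
    (ε := fun k ω => x k ω - S.observer P LW LP K v β x k ω) (u := fun k ω => T (v k ω))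
    (U := ∫ y, ‖T y‖ ^ 4 ∂(multivariateGaussian 0 S.Qv)) _ hK.tendsto_toEuclideanCLM ?_ hT
    (fun k => ?_) (fun k ω => observer_error_succ hC K k ω)
  · have : (fun ω => x 0 ω - S.observer P LW LP K v β x 0 ω) = x0 := by
      rw [hC.1]
      funext ω
      simp [System.observer]
    rw [this]
    exact memLp_initial hM
  · rw [← (hM.law_v k).map_eq, integral_map (hM.law_v k).aemeasurable]
    exact (by fun_prop : Continuous fun y => ‖T y‖ ^ 4).aestronglyMeasurable

theorem integral_silent_error_le [IsProbabilityMeasure P] {K : Matrix (Fin n) (Fin m) ℝ} {C : ℝ}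
    (hK : ∀ k, MemLp (fun ω => x k ω - S.observer P LW LP K v β x k ω) 4 P ∧
      ∫ ω, ‖x k ω - S.observer P LW LP K v β x k ω‖ ^ 4 ∂P ≤ C)
    (hM : S.IsRandomModel P x0 v β) (hC : S.IsClosedLoop P LW LP x0 v β x) {M : ℝ} (hM0 : 0 < M)
    (k : ℕ) :
    ∫ ω, ‖(silence β x k).indicator (fun ω => x k ω - S.embeddedEst P β v x k ω) ω‖ ^ 2 ∂P
      ≤ C / M ^ 2 + 3 * M ^ 2 * P.real (silence β x k ∩ {ω | x k ω ≠ 0}) := by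
  have hXm : Measurable (x k) := (measurable_state_pastInfo hC k k le_rfl).mono (pastInfo_le hM k)
    le_rfl
  have h := integral_indicator_sub_condExp_sq_le (embeddedInfo_le hM hC k) (memLp_state hM hC k)
    hXm (measurable_observer K k) (hK k).1
    (remoteInfo_le_embeddedInfo k _ (measurableSet_silence k)) hM0
  refine h.trans (add_le_add_left ?_ _)
  exact div_le_div_of_nonneg_right (hK k).2 (by positivity)

/-- The embedded controller's estimation error during silence vanishes in mean square. -/
theorem tendsto_integral_silent_error [IsProbabilityMeasure P] (hp1 : S.p < 1) (hdet : Detectable S.A S.H)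
    (hM : S.IsRandomModel P x0 v β) (hC : S.IsClosedLoop P LW LP x0 v β x) :
    Tendsto (fun k => ∫ ω, ‖(silence β x k).indicator
      (fun ω => x k ω - S.embeddedEst P β v x k ω) ω‖ ^ 2 ∂P) atTop (𝓝 0) := by
  obtain ⟨K, hK⟩ := hdet
  obtain ⟨C, hb⟩ := exists_observer_error_bound hK hM hC
  have hC0 : 0 ≤ C := (integral_nonneg fun _ => by positivity).trans (hb 0).2
  have hsil := tendsto_real_silence_ne_zero hp1 hM hC
  rw [Metric.tendsto_atTop]
  intro δ hδ
  -- Chosen so that `C / M ^ 2` is below `δ / 2`; the `+ 1` keeps `M` positive when `C = 0`. With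
  -- `M` fixed, the probability in the other term is made small by taking `k` large.
  let M : ℝ := Real.sqrt (2 * (C + 1) / δ)
  have hM0 : 0 < M := Real.sqrt_pos.2 (by positivity)
  have hM2 : M ^ 2 = 2 * (C + 1) / δ := Real.sq_sqrt (by positivity)
  have hCM : C / M ^ 2 < δ / 2 := by
    rw [hM2, div_div_eq_mul_div, div_lt_iff₀ (by positivity)]
    nlinarith
  obtain ⟨N, hN⟩ := (Metric.tendsto_atTop.1 hsil) (δ / 2 / (3 * M ^ 2)) (by positivity)
  refine ⟨N, fun k hk => ?_⟩
  have h1 := hN k hk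
  rw [Real.dist_eq, sub_zero, abs_of_nonneg measureReal_nonneg, lt_div_iff₀ (by positivity)] at h1
  have h2 := integral_silent_error_le hb hM hC hM0 k
  rw [Real.dist_eq, sub_zero, abs_of_nonneg (integral_nonneg fun _ => by positivity)]
  linarith

/-! ### The state -/

variable [IsProbabilityMeasure P]

/-- The disturbance of the recursion `A + B^P L^P` which the state follows during silence. -/
noncomputable def silentInput (S : System n w e m) (P : Measure Ω)
    (LW : Matrix (Fin w ⊕ Fin e) (Fin n) ℝ) (LP : Matrix (Fin e) (Fin n) ℝ)
    (v : ℕ → Ω → EuclideanSpace ℝ (Fin m)) (β : ℕ → Ω → ℝ)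
    (x : ℕ → Ω → EuclideanSpace ℝ (Fin n)) (k : ℕ) : Ω → EuclideanSpace ℝ (Fin n) := fun ω =>
  Matrix.toEuclideanCLM (𝕜 := ℝ) (S.B * LW - S.BP * LP)
      ((silence β x k).indicator (fun _ => silentMean P β x k) ω)
    + Matrix.toEuclideanCLM (𝕜 := ℝ) (-(S.BP * LP))
      ((silence β x k).indicator (fun ω => x k ω - S.embeddedEst P β v x k ω) ω)

theorem memLp_silentInput (hM : S.IsRandomModel P x0 v β)
    (hC : S.IsClosedLoop P LW LP x0 v β x) (k : ℕ) : MemLp (silentInput S P LW LP v β x k) 2 P := by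
  have hE := measurableSet_silence_ambient hM hC k
  have hX := memLp_state hM hC k
  have hP : MemLp (S.embeddedEst P β v x k) 2 P := hX.condExp one_le_two
  have h1 := (Matrix.toEuclideanCLM (𝕜 := ℝ) (S.B * LW - S.BP * LP)).comp_memLp'
    ((memLp_const (silentMean P β x k) (p := 2) (μ := P)).indicator hE)
  have h2 := (Matrix.toEuclideanCLM (𝕜 := ℝ) (-(S.BP * LP))).comp_memLp'
    ((hX.sub hP).indicator hE)
  exact h1.add h2

theorem tendsto_integral_silentInput (hp0 : 0 ≤ S.p) (hp1 : S.p < 1) (hdet : Detectable S.A S.H)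
    (hF : IsStable (S.A + S.B * LW)) (hM : S.IsRandomModel P x0 v β)
    (hC : S.IsClosedLoop P LW LP x0 v β x) :
    Tendsto (fun k => ∫ ω, ‖silentInput S P LW LP v β x k ω‖ ^ 2 ∂P) atTop (𝓝 0) := by
  set T₁ := Matrix.toEuclideanCLM (𝕜 := ℝ) (S.B * LW - S.BP * LP) with hT₁
  set T₂ := Matrix.toEuclideanCLM (𝕜 := ℝ) (-(S.BP * LP)) with hT₂
  have hlim : Tendsto (fun k => 2 * (‖T₁‖ ^ 2 * ‖silentMean P β x k‖ ^ 2)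
      + 2 * (‖T₂‖ ^ 2 * ∫ ω, ‖(silence β x k).indicator
        (fun ω => x k ω - S.embeddedEst P β v x k ω) ω‖ ^ 2 ∂P)) atTop (𝓝 0) := by
    have h1 := (((tendsto_silentMean hp0 hF hM hC).pow 2).const_mul (‖T₁‖ ^ 2)).const_mul 2
    have h2 := ((tendsto_integral_silent_error hp1 hdet hM hC).const_mul (‖T₂‖ ^ 2)).const_mul 2
    simpa using h1.add h2
  refine squeeze_zero (fun k => integral_nonneg fun _ => by positivity) (fun k => ?_) hlim
  have hE := measurableSet_silence_ambient hM hC k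
  have hX := memLp_state hM hC k
  have hP : MemLp (S.embeddedEst P β v x k) 2 P := hX.condExp one_le_two
  have m1 := (memLp_const (silentMean P β x k) (p := 2) (μ := P)).indicator hE
  have m2 := (hX.sub hP).indicator hE
  refine (integral_norm_add_sq_le (T₁.comp_memLp' m1) (T₂.comp_memLp' m2)).trans ?_
  have h1 : ∫ ω, ‖(silence β x k).indicator (fun _ => silentMean P β x k) ω‖ ^ 2 ∂P
      ≤ ‖silentMean P β x k‖ ^ 2 := by
    calc _ ≤ ∫ _, ‖silentMean P β x k‖ ^ 2 ∂P := by
          refine integral_mono (m1.integrable_norm_pow (p := 2) (by norm_num))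
            (integrable_const _) fun ω => ?_
          exact pow_le_pow_left₀ (norm_nonneg _) (norm_indicator_le_norm_self _ ω) 2
      _ = _ := by simp
  have h2 := integral_norm_clm_sq_le T₁ m1
  have h3 := integral_norm_clm_sq_le T₂ m2
  have h4 := mul_le_mul_of_nonneg_left h1 (by positivity : 0 ≤ ‖T₁‖ ^ 2)
  exact add_le_add (mul_le_mul_of_nonneg_left (h2.trans h4) zero_le_two)
    (mul_le_mul_of_nonneg_left h3 zero_le_two)

/-- Write the embedded estimate as the state minus its error and put `silentMean` for the remote
estimate: the state itself is then multiplied by `S.A + S.BP * LP`, and the rest is `silentInput`.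
-/
theorem state_succ_of_silence (hM : S.IsRandomModel P x0 v β)
    (hC : S.IsClosedLoop P LW LP x0 v β x) (k : ℕ) :
    ∀ᵐ ω ∂P, ω ∈ silence β x k → x (k + 1) ω
      = Matrix.toEuclideanCLM (𝕜 := ℝ) (S.A + S.BP * LP) ((silence β x k).indicator (x k) ω)
        + silentInput S P LW LP v β x k ω := by
  filter_upwards [remoteEst_eq_silentMean hM hC k] with ω h hω
  rw [hC.succ_apply, h hω, silentInput]
  simp only [hω, Set.indicator_of_mem, map_add, map_sub, map_neg, add_apply,
    sub_apply, neg_apply]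
  abel

/-- Silence events decrease, so the restricted state follows the stable recursion until silence ends
and is then reset to `0`. -/
theorem tendsto_integral_silent_state (hp0 : 0 ≤ S.p) (hp1 : S.p < 1) (hdet : Detectable S.A S.H)
    (hF : IsStable (S.A + S.B * LW)) (hG : IsStable (S.A + S.BP * LP))
    (hM : S.IsRandomModel P x0 v β) (hC : S.IsClosedLoop P LW LP x0 v β x) :
    Tendsto (fun k => ∫ ω, ‖(silence β x k).indicator (x k) ω‖ ^ 2 ∂P) atTop (𝓝 0) := by
  refine tendsto_integral_norm_sq_of_recursion _ hG.tendsto_toEuclideanCLM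
    (fun k => (memLp_state hM hC k).indicator (measurableSet_silence_ambient hM hC k))
    (memLp_silentInput hM hC) (tendsto_integral_silentInput hp0 hp1 hdet hF hM hC) fun k => ?_
  filter_upwards [state_succ_of_silence hM hC k] with ω h
  by_cases hω : ω ∈ silence β x (k + 1)
  · right
    rw [Set.indicator_of_mem hω]
    exact h (silence_anti k.le_succ hω)
  · left
    exact Set.indicator_of_notMem hω _

/-- The state at the moment silence breaks is the input of the recursion off silence. It is one
bounded linear step away from the silent state, up to a vanishing disturbance. -/
theorem tendsto_integral_silent_state_succ (hp0 : 0 ≤ S.p) (hp1 : S.p < 1)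
    (hdet : Detectable S.A S.H) (hF : IsStable (S.A + S.B * LW)) (hG : IsStable (S.A + S.BP * LP))
    (hM : S.IsRandomModel P x0 v β) (hC : S.IsClosedLoop P LW LP x0 v β x) :
    Tendsto (fun k => ∫ ω, ‖(silence β x k \ silence β x (k + 1)).indicator (x (k + 1)) ω‖ ^ 2 ∂P)
      atTop (𝓝 0) := by
  set G := Matrix.toEuclideanCLM (𝕜 := ℝ) (S.A + S.BP * LP) with hGdef
  have hlim : Tendsto (fun k => 2 * (‖G‖ ^ 2 * ∫ ω, ‖(silence β x k).indicator (x k) ω‖ ^ 2 ∂P)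
      + 2 * ∫ ω, ‖silentInput S P LW LP v β x k ω‖ ^ 2 ∂P) atTop (𝓝 0) := by
    have h1 := ((tendsto_integral_silent_state hp0 hp1 hdet hF hG hM hC).const_mul
      (‖G‖ ^ 2)).const_mul 2
    have h2 := (tendsto_integral_silentInput hp0 hp1 hdet hF hM hC).const_mul 2
    simpa using h1.add h2
  refine squeeze_zero (fun k => integral_nonneg fun _ => by positivity) (fun k => ?_) hlim
  have hE := measurableSet_silence_ambient hM hC k
  have hE' := measurableSet_silence_ambient hM hC (k + 1)
  have m1 := (memLp_state hM hC k).indicator hE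
  have m2 := memLp_silentInput hM hC k
  have m3 := (memLp_state hM hC (k + 1)).indicator (hE.diff hE')
  have m12 := (G.comp_memLp' m1).add m2
  calc _ ≤ ∫ ω, ‖G ((silence β x k).indicator (x k) ω) + silentInput S P LW LP v β x k ω‖ ^ 2 ∂P := by
        refine integral_mono_ae (m3.integrable_norm_pow (p := 2) (by norm_num))
          (m12.integrable_norm_pow (p := 2) (by norm_num)) ?_
        filter_upwards [state_succ_of_silence hM hC k] with ω h
        by_cases hω : ω ∈ silence β x k \ silence β x (k + 1)
        · rw [Set.indicator_of_mem hω, h hω.1]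
        · rw [Set.indicator_of_notMem hω, norm_zero, zero_pow two_ne_zero]
          positivity
    _ ≤ _ := integral_norm_add_sq_le (G.comp_memLp' m1) m2
    _ ≤ _ := by gcongr; exact integral_norm_clm_sq_le G m1

/-- Off silence the state moves by `S.A + S.B * LW`. Each outcome enters this regime at most once,
at the exit from silence, and these entries are the vanishing input. -/
theorem tendsto_integral_informed_state (hp0 : 0 ≤ S.p) (hp1 : S.p < 1)
    (hdet : Detectable S.A S.H) (hF : IsStable (S.A + S.B * LW)) (hG : IsStable (S.A + S.BP * LP))
    (hM : S.IsRandomModel P x0 v β) (hC : S.IsClosedLoop P LW LP x0 v β x) :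
    Tendsto (fun k => ∫ ω, ‖(silence β x k)ᶜ.indicator (x k) ω‖ ^ 2 ∂P) atTop (𝓝 0) := by
  have hE := measurableSet_silence_ambient hM hC
  refine tendsto_integral_norm_sq_of_recursion _ hF.tendsto_toEuclideanCLM
    (fun k => (memLp_state hM hC k).indicator (hE k).compl)
    (fun k => (memLp_state hM hC (k + 1)).indicator ((hE k).diff (hE (k + 1))))
    (tendsto_integral_silent_state_succ hp0 hp1 hdet hF hG hM hC) fun k => ?_
  filter_upwards [ests_eq_state hM hC k] with ω h
  by_cases hω' : ω ∈ silence β x (k + 1)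
  · left
    exact Set.indicator_of_notMem (Set.notMem_compl_iff.2 hω') _
  · right
    rw [Set.indicator_of_mem (show ω ∈ (silence β x (k + 1))ᶜ from hω')]
    by_cases hω : ω ∈ silence β x k
    · rw [Set.indicator_of_notMem (Set.notMem_compl_iff.2 hω), Set.indicator_of_mem (Set.mem_sdiff_of_mem hω hω'), map_zero,
        zero_add]
    · obtain ⟨h1, h2⟩ := h hω
      rw [Set.indicator_of_mem (show ω ∈ (silence β x k)ᶜ from hω),
        Set.indicator_of_notMem (fun h => hω h.1), add_zero, hC.succ_apply, h1, h2, sub_self,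
        map_zero, add_zero, map_add]
      rfl

theorem tendsto_integral_state (hp0 : 0 ≤ S.p) (hp1 : S.p < 1) (hdet : Detectable S.A S.H)
    (hF : IsStable (S.A + S.B * LW)) (hG : IsStable (S.A + S.BP * LP))
    (hM : S.IsRandomModel P x0 v β) (hC : S.IsClosedLoop P LW LP x0 v β x) :
    Tendsto (fun k => ∫ ω, ‖x k ω‖ ^ 2 ∂P) atTop (𝓝 0) := by
  have hlim := (tendsto_integral_silent_state hp0 hp1 hdet hF hG hM hC).add
    (tendsto_integral_informed_state hp0 hp1 hdet hF hG hM hC)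
  rw [add_zero] at hlim
  refine hlim.congr fun k => ?_
  have hE := measurableSet_silence_ambient hM hC k
  have hX := memLp_state hM hC k
  rw [← integral_add ((hX.indicator hE).integrable_norm_pow (p := 2) (by norm_num))
    ((hX.indicator hE.compl).integrable_norm_pow (p := 2) (by norm_num))]
  refine integral_congr_ae (ae_of_all _ fun ω => ?_)
  by_cases hω : ω ∈ silence β x k
  · simp [hω]
  · simp [hω]

end Convergence

end NCS

theorem corollary1 {n w e m : ℕ} (S : NCS.System n w e m)
    (Q : Matrix (Fin n) (Fin n) ℝ) (RW : Matrix (Fin w) (Fin w) ℝ)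
    (RP : Matrix (Fin e) (Fin e) ℝ)
    -- standing conventions of the model
    (hp0 : 0 ≤ S.p) (hp1 : S.p < 1) (hQv : S.Qv.PosSemidef)
    -- weights
    (hRP : RP.PosDef) (hRW : RW.PosDef) (hQ : Q.PosSemidef)
    -- observability of the pair of `A` and the square root of `Q`; detectability
    (hobs : ∃ C : Matrix (Fin n) (Fin n) ℝ, C.PosSemidef ∧ C * C = Q ∧ NCS.Observable S.A C)
    (hdet : NCS.Detectable S.A S.H)
    -- stabilizability
    (hstab : NCS.Stabilizable S.A S.B)
    (hstabP : NCS.Stabilizable S.A S.BP)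
    -- observability condition that involves the positive definite Riccati solution
    (hobsP : ∀ PW : Matrix (Fin n) (Fin n) ℝ, PW.PosDef → S.SolvesRiccati Q RW RP PW →
      ∃ D : Matrix (Fin n) (Fin n) ℝ,
        S.p • Q + (1 - S.p) • PW = D * Dᵀ ∧ NCS.Observable S.A D) :
    NCS.System.MeanSquareStabilizable.{u} S := by
  obtain ⟨LW, hF⟩ := hstab
  obtain ⟨LP, hG⟩ := hstabP
  refine ⟨LW, LP, fun Ω _ P _ x0 v β x hM hC => ⟨fun k => ?_, ?_⟩⟩
  · exact (NCS.memLp_state hM hC k).integrable_norm_pow two_ne_zero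
  · exact NCS.tendsto_integral_state hp0 hp1 hdet hF hG hM hC
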